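/- Conventions. All locally compact second countable (lcsc) groups are Hausdorff; a Lebesgue measure space is a standard Borel space with a $\sigma$-finite measure, and isomorphisms of measure spaces are understood modulo null sets; $m_G$ is a Haar measure on $G$. For unimodular lcsc groups $G,H$, a $(G,H)$-coupling is a Lebesgue measure space $(\Omega,m)$, $m\neq 0$, with a measurable measure-preserving action of $G\times H$ for which there are finite measure spaces $(Y,\nu),(X,\mu)$ and isomorphisms $i:(G,m_G)\times(Y,\nu)\to(\Omega,m)$ and $j:(H,m_H)\times(X,\mu)\to(\Omega,m)$ with $g\cdot i(g',y)=i(gg',y)$ and $h\cdot j(h',x)=j(hh',x)$. The corresponding ME-cocycles $\alpha:G\times X\to H$ and $\beta:H\times Y\to G$ are given by $g\cdot j(h,x)=j(h\,\alpha(g,x)^{-1},g.x)$ and $h\cdot i(g,y)=i(g\,\beta(h,y)^{-1},h.y)$. For $p\in[1,\infty]$ the coupling is $L^p$-integrable if $G$ and $H$ are compactly generated and $i,j$ can be chosen so that $x\mapsto|\alpha(g,x)|_H$ is in $L^p(X,\mu)$ for a.e. $g\in G$ and $y\mapsto|\beta(h,y)|_G$ is in $L^p(Y,\nu)$ for a.e.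 $h\in H$, where $|\cdot|$ denotes the word norm of a compact symmetric generating set. A lattice $\Gamma<G$ is a discrete subgroup such that $G/\Gamma$ carries a $G$-invariant Borel probability measure; it is $L^p$-integrable if $(G,m_G)$ with the action $(g,\gamma):g'\mapsto gg'\gamma^{-1}$ is an $L^p$-integrable $(G,\Gamma)$-coupling. Let $\pi:G\to\mathcal G$ be a continuous homomorphism to a Polish group. $G$ is taut (resp. $p$-taut) relative to $\pi$ if for every (resp. every $L^p$-integrable) $(G,G)$-coupling $(\Omega,m)$ there is a measurable map $\Phi:\Omega\to\mathcal G$, unique up to null sets, such that for $m$-a.e. $\omega$ and all $g_1,g_2\in G$ one has $\Phi((g_1,g_2)\omega)=\pi(g_1)\Phi(\omega)\pi(g_2)^{-1}$. $G$ is taut if it is taut relative to $\mathrm{id}:G\to G$. $\mathcal G$ is strongly ICC relative to a subgroup $\mathcal G_0$ if there is no Borel probability measure on $\mathcal G\setminus\{e\}$ invariant under conjugation by all elements of $\mathcal G_0$. Proposition. Let $G$ be a unimodular lcsc group, $\mathcal G$ a Polish group, $\pi:G\to\mathcal G$ a continuous homomorphism, and $\Gamma<G$ a lattice. (1) Assume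 that $\mathcal G$ is strongly ICC relative to $\pi(G)$. Then $G$ is taut relative to $\pi$ if and only if $\Gamma$ is taut relative to $\pi|_\Gamma:\Gamma\to\mathcal G$. Moreover, for every $p\in[1,\infty]$ for which the lattice $\Gamma$ is $L^p$-integrable, $G$ is $p$-taut relative to $\pi$ if and only if $\Gamma$ is $p$-taut relative to $\pi|_\Gamma$. (2) In particular, $G$ is taut if and only if $\Gamma$ is taut relative to the inclusion $\Gamma<G$. Hence (as $G$ has a lattice) the following are equivalent: $G$ is taut; some lattice in $G$ is taut relative to its inclusion into $G$; every lattice in $G$ is taut relative to its inclusion into $G$. -/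

import Mathlib

open MeasureTheory MeasureTheory.Measure
open scoped ENNReal Pointwise

universe u v

namespace MeasEquiv

/-! Throughout, Lebesgue measure spaces are modelled by standard Borel spaces with a (`σ`-finite)
Borel measure, and maps between them are considered up to null sets. A standard Borel space in any
universe is Borel isomorphic to one in `Type u`, so quantifying over `Type u` loses nothing. -/

section Couplings

variable (G H : Type u)
  [Group G] [TopologicalSpace G] [IsTopologicalGroup G] [LocallyCompactSpace G]
  [MeasurableSpace G] [BorelSpace G]
  [Group H] [TopologicalSpace H] [IsTopologicalGroup H] [LocallyCompactSpace H]
  [MeasurableSpace H] [BorelSpace H]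

/-- Let `K` act on the measure space `(Ω, m)` through `a : K → Ω → Ω`. A `FundamentalIso` is a
measure space isomorphism (mod null sets) `(K, m_K) × (Y, ν) ≅ (Ω, m)` which is equivariant
for left translation on the `K`-coordinate: `k · i(k', y) = i(k k', y)`. -/
structure FundamentalIso (K : Type u) [Group K] [TopologicalSpace K] [IsTopologicalGroup K]
    [LocallyCompactSpace K] [MeasurableSpace K] [BorelSpace K]
    {Ω : Type u} [MeasurableSpace Ω] (a : K → Ω → Ω) (m : Measure Ω)
    (Y : Type u) [MeasurableSpace Y] (ν : Measure Y) where
  toFun : K × Y → Ω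
  invFun : Ω → K × Y
  measurePreserving_toFun : MeasurePreserving toFun ((haar : Measure K).prod ν) m
  measurable_invFun : Measurable invFun
  left_inv : ∀ᵐ p ∂((haar : Measure K).prod ν), invFun (toFun p) = p
  right_inv : ∀ᵐ ω ∂m, toFun (invFun ω) = ω
  equivariant : ∀ᵐ p ∂((haar : Measure K).prod ν), ∀ k : K,
    toFun (k * p.1, p.2) = a k (toFun p)

/-- The action of the first factor of `G × H`. -/
def leftAct {Ω : Type u} [MulAction (G × H) Ω] : G → Ω → Ω := fun g ω => (g, (1 : H)) • ω

/-- The action of the second factor of `G × H`. -/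
def rightAct {Ω : Type u} [MulAction (G × H) Ω] : H → Ω → Ω := fun h ω => ((1 : G), h) • ω

/-- `(Ω, m)` with its `G × H`-action is a `(G, H)`-coupling. -/
structure IsCoupling {Ω : Type u} [MeasurableSpace Ω] [MulAction (G × H) Ω]
    (m : Measure Ω) : Prop where
  standardBorel : StandardBorelSpace Ω
  sigmaFinite : SigmaFinite m
  ne_zero : m ≠ 0
  measurable_action : MeasurableSMul₂ (G × H) Ω
  invariant : SMulInvariantMeasure (G × H) Ω m
  exists_left : ∃ (Y : Type u) (_ : MeasurableSpace Y) (_ : StandardBorelSpace Y)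
    (ν : Measure Y) (_ : IsFiniteMeasure ν), Nonempty (FundamentalIso G (leftAct G H) m Y ν)
  exists_right : ∃ (X : Type u) (_ : MeasurableSpace X) (_ : StandardBorelSpace X)
    (μ : Measure X) (_ : IsFiniteMeasure μ), Nonempty (FundamentalIso H (rightAct G H) m X μ)

/-- Let `K` and `L` have commuting actions `a`, `b` on `(Ω, m)` and let
`i : (K, m_K) × (Y, ν) ≅ (Ω, m)` be a `K`-equivariant isomorphism. The corresponding ME-cocycle
`c : L × Y → K` is determined up to null sets by `l · i(k, y) = i(k c(l, y)⁻¹, l.y)`, i.e. by the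
`K`-coordinate of this identity. -/
def IsMECocycle {K L : Type u} [Group K] [TopologicalSpace K] [IsTopologicalGroup K]
    [LocallyCompactSpace K] [MeasurableSpace K] [BorelSpace K] [MeasurableSpace L]
    {Ω : Type u} [MeasurableSpace Ω] {a : K → Ω → Ω} {m : Measure Ω}
    {Y : Type u} [MeasurableSpace Y] {ν : Measure Y}
    (i : FundamentalIso K a m Y ν) (b : L → Ω → Ω) (c : L × Y → K) : Prop :=
  Measurable c ∧
    ∀ l : L, ∀ᵐ p ∂((haar : Measure K).prod ν),
      (i.invFun (b l (i.toFun p))).1 = p.1 * (c (l, p.2))⁻¹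

/-- A compact symmetric generating set. -/
def IsCompactGenerating {K : Type u} [Group K] [TopologicalSpace K] (S : Set K) : Prop :=
  IsCompact S ∧ S⁻¹ = S ∧ Subgroup.closure S = ⊤

/-- The word norm `|g|_S = min {n | g ∈ Sⁿ}`. -/
noncomputable def wordNorm {K : Type u} [Group K] (S : Set K) (g : K) : ℕ :=
  sInf {n : ℕ | g ∈ S ^ n}

/-- `L^p`-integrability of `c : L × Y → K`, where `K` is compactly generated. Word norms of any two
compact generating sets are equivalent, so the choice of `S` does not matter. For `p = ∞` the
condition says that `|c(l, ·)|` is essentially bounded for a.e. `l`. -/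
def IsLpCocycle (p : ℝ≥0∞) {K L : Type u} [Group K] [TopologicalSpace K]
    [Group L] [TopologicalSpace L] [IsTopologicalGroup L]
    [LocallyCompactSpace L] [MeasurableSpace L] [BorelSpace L]
    {Y : Type u} [MeasurableSpace Y] (ν : Measure Y) (c : L × Y → K) : Prop :=
  ∃ S : Set K, IsCompactGenerating S ∧
    ∀ᵐ l ∂(haar : Measure L), MemLp (fun y => (wordNorm S (c (l, y)) : ℝ)) p ν

/-- `L^p`-integrability of a `(G, H)`-coupling: for suitable isomorphisms
`i : G × Y ≅ Ω`, `j : H × X ≅ Ω` both ME-cocycles `β : H × Y → G`, `α : G × X → H` are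
`L^p`-integrable. In particular `G` and `H` are compactly generated. -/
def IsLpIntegrable (p : ℝ≥0∞) {Ω : Type u} [MeasurableSpace Ω] [MulAction (G × H) Ω]
    (m : Measure Ω) : Prop :=
  (∃ (Y : Type u) (_ : MeasurableSpace Y) (_ : StandardBorelSpace Y)
      (ν : Measure Y) (_ : IsFiniteMeasure ν) (i : FundamentalIso G (leftAct G H) m Y ν)
      (β : H × Y → G), IsMECocycle i (rightAct G H) β ∧ IsLpCocycle p ν β) ∧
  (∃ (X : Type u) (_ : MeasurableSpace X) (_ : StandardBorelSpace X)
      (μ : Measure X) (_ : IsFiniteMeasure μ) (j : FundamentalIso H (rightAct G H) m X μ)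
      (α : G × X → H), IsMECocycle j (leftAct G H) α ∧ IsLpCocycle p μ α)

end Couplings

section Taut

variable {G : Type u} {P : Type v} [Group G] [Group P] [MeasurableSpace P]

/-- `Φ` is a tautening map relative to `π : G → P`. -/
def IsTautening (π : G →* P) {Ω : Type u} [MeasurableSpace Ω] [MulAction (G × G) Ω]
    (m : Measure Ω) (Φ : Ω → P) : Prop :=
  Measurable Φ ∧ ∀ᵐ ω ∂m, ∀ g₁ g₂ : G, Φ ((g₁, g₂) • ω) = π g₁ * Φ ω * (π g₂)⁻¹

/-- The coupling `(Ω, m)` is taut relative to `π`: there is a tautening map and it is unique up to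
null sets. -/
def IsTautCoupling (π : G →* P) {Ω : Type u} [MeasurableSpace Ω] [MulAction (G × G) Ω]
    (m : Measure Ω) : Prop :=
  ∃ Φ : Ω → P, IsTautening π m Φ ∧ ∀ Ψ : Ω → P, IsTautening π m Ψ → Ψ =ᵐ[m] Φ

variable [TopologicalSpace G] [IsTopologicalGroup G] [LocallyCompactSpace G]
  [MeasurableSpace G] [BorelSpace G]

/-- `G` is taut relative to `π : G → P`. -/
def IsTautRel (π : G →* P) : Prop :=
  ∀ (Ω : Type u) [MeasurableSpace Ω] [MulAction (G × G) Ω] (m : Measure Ω),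
    IsCoupling G G m → IsTautCoupling π m

/-- `G` is `p`-taut relative to `π : G → P`. -/
def IsPTautRel (p : ℝ≥0∞) (π : G →* P) : Prop :=
  ∀ (Ω : Type u) [MeasurableSpace Ω] [MulAction (G × G) Ω] (m : Measure Ω),
    IsCoupling G G m → IsLpIntegrable G G p m → IsTautCoupling π m

variable (G) in
/-- `G` is taut: every `(G, G)`-coupling `Ω` has an essentially unique measurable
`Φ : Ω → G` with `Φ((g₁, g₂)ω) = g₁ Φ(ω) g₂⁻¹`. -/
def IsTaut : Prop := IsTautRel (MonoidHom.id G)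

end Taut

/-- `P` is strongly ICC relative to the subgroup `P₀`: no Borel probability measure on
`P ∖ {1}` is invariant under conjugation by `P₀`. -/
def IsStronglyICCRel {P : Type v} [Group P] [MeasurableSpace P] (P₀ : Subgroup P) : Prop :=
  ¬ ∃ μ : Measure P, IsProbabilityMeasure μ ∧ μ {1} = 0 ∧
    ∀ g ∈ P₀, μ.map (fun x => g * x * g⁻¹) = μ

section Lattices

variable {G : Type u} [Group G] [TopologicalSpace G] [MeasurableSpace G]

/-- A lattice: a discrete subgroup such that `G ⧸ Γ` carries a `G`-invariant probability
measure. -/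
class IsLattice (Γ : Subgroup G) : Prop where
  discrete : DiscreteTopology Γ
  exists_invariant : ∃ μ : Measure (G ⧸ Γ), IsProbabilityMeasure μ ∧ SMulInvariantMeasure G (G ⧸ Γ) μ

attribute [instance] IsLattice.discrete

/-- The action `(g, γ) : g' ↦ g g' γ⁻¹` of `G × Γ` on `G`. -/
@[reducible]
def latticeAction (Γ : Subgroup G) : MulAction (G × Γ) G where
  smul a x := a.1 * x * ((a.2 : G))⁻¹
  one_smul x := by
    change (1 : G) * x * ((1 : Γ) : G)⁻¹ = x
    simp
  mul_smul a b x := by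
    change (a.1 * b.1) * x * (((a.2 * b.2 : Γ)) : G)⁻¹
      = a.1 * (b.1 * x * ((b.2 : G))⁻¹) * ((a.2 : G))⁻¹
    simp [mul_assoc]

/-- The lattice `Γ < G` is `L^p`-integrable: `(G, m_G)` is an `L^p`-integrable
`(G, Γ)`-coupling. -/
def IsLpLattice (p : ℝ≥0∞) [IsTopologicalGroup G] [LocallyCompactSpace G] [BorelSpace G]
    (Γ : Subgroup G) [IsLattice Γ] : Prop :=
  letI : MulAction (G × Γ) G := latticeAction Γ
  IsLpIntegrable G Γ p (haar : Measure G)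

end Lattices

end MeasEquiv

open MeasEquiv

/-!
Couplings are moved between `G` and `Γ` in both directions. Fix a Borel fundamental domain
`D ≅ G/Γ` with its cocycle `G × D → Γ`; it has finite measure, and `G ≅ D × Γ`.

*From `G` to `Γ`.* A `(Γ, Γ)`-coupling `Ω` induces the `(G, G)`-coupling `G ×_Γ Ω ×_Γ G`, which is
`D × D × Ω` with an action twisted by the cocycle (`IsDomainCoord.isCoupling_induced`). In the fibre
over `(d₁, d₂)` the group `d₁Γd₁⁻¹ × d₂Γd₂⁻¹` acts as `Γ × Γ` acts on `Ω`, so a tautening map of the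
induced coupling gives one of `Ω` on almost every fibre; conversely a tautening map of `Ω` induces
one of `G ×_Γ Ω ×_Γ G`, which yields uniqueness (`IsDomainCoord.isTautCoupling_of_induced`).

*From `Γ` to `G`.* A `(G, G)`-coupling `Ω` is also a `(Γ, Γ)`-coupling (`isCoupling_restrict`). Its
tautening map `Φ` extends to the `G × G`-equivariant map
`(d₁, d₂, ω) ↦ π(d₁) Φ((d₁, d₂)⁻¹ω) π(d₂)⁻¹` on `D × D × Ω`. Here the strong ICC property enters:
two equivariant maps `F₁, F₂` into the target agree (`ae_eq_of_equivariant`), because `F₁F₂⁻¹`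
descends to the finite measure space `Ω/(1 × G)`, where its distribution is invariant under
conjugation. Hence the extended map does not depend on `D × D` and descends to `Ω`
(`isTautCoupling_of_restrict`). Finally an equivariant map, for which the exceptional null set may
depend on the group element, is corrected on a null set to one with a common exceptional set
(`exists_isTautening`).

*Integrability.* The ME-cocycles of induced and restricted couplings are compositions of the given
ones with the cocycle of the lattice. The `L^p`-norm of `|c(l, ·)|` is a subadditive, symmetric
function of `l` that is finite almost everywhere; by Steinhaus' theorem it is bounded on compact
sets, so it is at most linear in the word norm of `l` (`exists_eLpNorm_cocycle_le`). Therefore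
compositions of `L^p`-integrable cocycles are `L^p`-integrable (`memLp_prod_of_eLpNorm_le`).

*The identity of `G`.* For part (2) the strong ICC property need not be assumed. A probability
measure `μ` on `G` that is invariant under conjugation by `Γ` and has no atom at the identity makes
`Γ × (G, μ)` into a `(Γ, Γ)`-coupling with two different tautening maps
(`IsTautRel.isStronglyICCRel`).

Invariance of the measures on all these quotients, for which no quotient space is
formed, is a consequence of one computation with Tonelli's theorem (`mass_transport`).
-/

set_option linter.unusedSectionVars false

/-! ### Locally compact second countable groups -/

theorem MeasurableEquiv.standardBorelSpace {α β : Type*} [MeasurableSpace α]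
    [MeasurableSpace β] (e : α ≃ᵐ β) (h : StandardBorelSpace α) : StandardBorelSpace β := by
  obtain ⟨τ, hb, hp⟩ := h.polish
  let t : TopologicalSpace β := TopologicalSpace.induced e.symm τ
  have : PolishSpace β := e.symm.toEquiv.polishSpace_induced
  refine ⟨t, ⟨?_⟩, inferInstance⟩
  refine e.symm.measurableEmbedding.comap_eq.symm.trans ?_
  exact (congrArg (MeasurableSpace.comap e.symm) hb.measurable_eq).trans borel_comap.symm

/-- A locally compact second countable Hausdorff group is metrizable, and it is `σ`-compact, hence
Borel, in the completion for a compatible metric. -/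
theorem standardBorelSpace_of_lcsc (G : Type u) [Group G] [TopologicalSpace G]
    [IsTopologicalGroup G] [LocallyCompactSpace G] [SecondCountableTopology G] [T2Space G]
    [MeasurableSpace G] [BorelSpace G] : StandardBorelSpace G := by
  let _ := TopologicalSpace.metrizableSpaceMetric G
  let _ : MeasurableSpace (UniformSpace.Completion G) := borel _
  have : BorelSpace (UniformSpace.Completion G) := ⟨rfl⟩
  have hemb : Topology.IsEmbedding ((↑) : G → UniformSpace.Completion G) :=
    UniformSpace.Completion.coe_isometry.isEmbedding
  have hrange : MeasurableSet (Set.range ((↑) : G → UniformSpace.Completion G)) := by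
    rw [← Set.image_univ, ← iUnion_compactCovering, Set.image_iUnion]
    exact MeasurableSet.iUnion fun n =>
      ((isCompact_compactCovering G n).image hemb.continuous).isClosed.measurableSet
  have : SecondCountableTopology (UniformSpace.Completion G) := inferInstance
  have : PolishSpace (UniformSpace.Completion G) := inferInstance
  exact (hemb.measurableEmbedding hrange).equivRange.symm.standardBorelSpace hrange.standardBorel

/-- The Haar measure of a unimodular group is invariant under inversion. -/
theorem haar_isInvInvariant (G : Type u) [Group G] [TopologicalSpace G]
    [IsTopologicalGroup G] [LocallyCompactSpace G] [SecondCountableTopology G]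
    [MeasurableSpace G] [BorelSpace G] [(haar : Measure G).IsMulRightInvariant] :
    (haar : Measure G).IsInvInvariant := by
  constructor
  let μ : Measure G := haar
  have : IsFiniteMeasureOnCompacts μ.inv := by
    refine ⟨fun K hK => ?_⟩
    rw [Measure.inv_apply]
    exact hK.inv.measure_lt_top
  let c : ℝ≥0∞ := haarScalarFactor μ.inv μ
  have hc : μ.inv = c • μ := isMulLeftInvariant_eq_smul μ.inv μ
  have : map Inv.inv (map Inv.inv μ) = c ^ 2 • μ := by
    rw [← inv_def μ, hc, Measure.map_smul, ← inv_def μ, hc, smul_smul, pow_two]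
  have μeq : μ = c ^ 2 • μ := by
    rw [map_map continuous_inv.measurable continuous_inv.measurable] at this
    simpa only [inv_involutive, Function.Involutive.comp_self, Measure.map_id]
  have K : TopologicalSpace.PositiveCompacts G := Classical.arbitrary _
  have : c ^ 2 * μ K = 1 ^ 2 * μ K := by
    conv_rhs => rw [μeq]
    simp
  have : c ^ 2 = 1 ^ 2 :=
    (ENNReal.mul_left_inj (measure_pos_of_nonempty_interior _ K.interior_nonempty).ne'
          K.isCompact.measure_lt_top.ne).1 this
  have : c = 1 := (ENNReal.pow_right_strictMono two_ne_zero).injective this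
  change μ.inv = μ
  rw [hc, this, one_smul]

section Discrete

variable (H : Type u) [Group H] [TopologicalSpace H] [DiscreteTopology H] [IsTopologicalGroup H]
  [MeasurableSpace H] [BorelSpace H]

/-- The Haar mass of a point of a discrete group. -/
noncomputable def haarPoint : ℝ≥0∞ := (haar : Measure H) {1}

theorem haarPoint_ne_zero : haarPoint H ≠ 0 :=
  (isOpen_discrete ({1} : Set H)).measure_pos haar (Set.singleton_nonempty 1) |>.ne'

theorem haarPoint_ne_top : haarPoint H ≠ ∞ :=
  (isCompact_singleton (x := (1 : H))).measure_lt_top.ne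

theorem haar_eq_smul_count [Countable H] : (haar : Measure H) = haarPoint H • count := by
  refine Measure.ext_of_singleton fun h => ?_
  have : (haar : Measure H) {h} = haarPoint H := by
    simp [haarPoint]
  rw [this]
  simp

theorem haar_isMulRightInvariant_of_discrete [Countable H] :
    (haar : Measure H).IsMulRightInvariant := by
  rw [haar_eq_smul_count]; infer_instance

theorem lintegral_haar_discrete [Countable H] (f : H → ℝ≥0∞) :
    ∫⁻ h, f h ∂(haar : Measure H) = haarPoint H * ∑' h, f h := by
  rw [haar_eq_smul_count, lintegral_smul_measure, lintegral_count, smul_eq_mul]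

end Discrete

/-! ### Mass transport between equivariant maps -/

/-- A measurable, measure preserving action of `K`, given as a function `K → Ω → Ω`. -/
structure IsMPAction {K : Type u} [Group K] [MeasurableSpace K] {Ω : Type u} [MeasurableSpace Ω]
    (a : K → Ω → Ω) (m : Measure Ω) : Prop where
  measurable : Measurable (fun p : K × Ω => a p.1 p.2)
  one : ∀ ω, a 1 ω = ω
  mul : ∀ k l ω, a (k * l) ω = a k (a l ω)
  map : ∀ k, MeasurePreserving (a k) m m

namespace IsMPAction

variable {K : Type u} [Group K] [MeasurableSpace K] {Ω : Type u} [MeasurableSpace Ω]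
    {a : K → Ω → Ω} {m : Measure Ω}

theorem inv_self (h : IsMPAction a m) (k : K) (ω : Ω) : a k⁻¹ (a k ω) = ω := by
  rw [← h.mul, inv_mul_cancel, h.one]

end IsMPAction

/-- Let `K` be unimodular, let `θ, θ' : Ω → K` be equivariant and let `F` be invariant. Then
`∫_{θ ∈ E} F` is proportional to the Haar measure of `E`, with a factor that does not depend on `θ`;
for `E` of finite positive measure this factor is the integral of `F` over the quotient by `K`.
The proof is Tonelli's theorem for `(k, ω) ↦ 1_E(θ ω) F(ω) 1_{E'}(θ'(k ω))`. -/
theorem mass_transport {K : Type u} [Group K] [TopologicalSpace K] [IsTopologicalGroup K]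
    [LocallyCompactSpace K] [SecondCountableTopology K] [MeasurableSpace K] [BorelSpace K]
    [(haar : Measure K).IsMulRightInvariant]
    {Ω : Type u} [MeasurableSpace Ω] {a : K → Ω → Ω} {m : Measure Ω} [SFinite m]
    (ha : IsMPAction a m) {θ θ' : Ω → K} (hθ : Measurable θ) (hθ' : Measurable θ')
    (eθ : ∀ k, ∀ᵐ ω ∂m, θ (a k ω) = k * θ ω) (eθ' : ∀ k, ∀ᵐ ω ∂m, θ' (a k ω) = k * θ' ω)
    {F : Ω → ℝ≥0∞} (hF : Measurable F) (eF : ∀ k, ∀ᵐ ω ∂m, F (a k ω) = F ω)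
    {E E' : Set K} (hE : MeasurableSet E) (hE' : MeasurableSet E') :
    (haar : Measure K) E' * ∫⁻ ω in θ ⁻¹' E, F ω ∂m =
      (haar : Measure K) E * ∫⁻ ω in θ' ⁻¹' E', F ω ∂m := by
  have := haar_isInvInvariant K
  let e : K → ℝ≥0∞ := E.indicator 1
  let e' : K → ℝ≥0∞ := E'.indicator 1
  have he : Measurable e := measurable_one.indicator hE
  have he' : Measurable e' := measurable_one.indicator hE'
  have int_right : ∀ x : K, ∫⁻ k, e' (k * x) ∂haar = (haar : Measure K) E' := fun x => by
    rw [lintegral_mul_right_eq_self, lintegral_indicator_one hE']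
  have int_inv : ∀ x : K, ∫⁻ k, e (k⁻¹ * x) ∂haar = (haar : Measure K) E := fun x => by
    have := lintegral_inv_eq_self (μ := (haar : Measure K)) (fun k => e (k * x))
    rw [this, lintegral_mul_right_eq_self, lintegral_indicator_one hE]
  have lhs : ∫⁻ ω in θ ⁻¹' E, F ω ∂m = ∫⁻ ω, e (θ ω) * F ω ∂m := by
    rw [← lintegral_indicator (hθ hE)]
    refine lintegral_congr fun ω => ?_
    by_cases h : θ ω ∈ E <;> simp [e, h]
  have rhs : ∫⁻ ω in θ' ⁻¹' E', F ω ∂m = ∫⁻ ω, e' (θ' ω) * F ω ∂m := by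
    rw [← lintegral_indicator (hθ' hE')]
    refine lintegral_congr fun ω => ?_
    by_cases h : θ' ω ∈ E' <;> simp [e', h]
  rw [lhs, rhs]
  have meas1 : Measurable fun p : Ω × K => e (θ p.1) * F p.1 * e' (p.2 * θ' p.1) := by fun_prop
  have meas2 : Measurable fun p : K × Ω => e (p.1⁻¹ * θ p.2) * F p.2 * e' (θ' p.2) := by fun_prop
  calc (haar : Measure K) E' * ∫⁻ ω, e (θ ω) * F ω ∂m
      = ∫⁻ ω, ∫⁻ k, e (θ ω) * F ω * e' (k * θ' ω) ∂haar ∂m := by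
        rw [mul_comm, ← lintegral_mul_const _ (by fun_prop)]
        refine lintegral_congr fun ω => ?_
        rw [lintegral_const_mul _ (by fun_prop), int_right]
    _ = ∫⁻ k, ∫⁻ ω, e (θ ω) * F ω * e' (k * θ' ω) ∂m ∂haar :=
        lintegral_lintegral_swap meas1.aemeasurable
    _ = ∫⁻ k, ∫⁻ ω, e (k⁻¹ * θ ω) * F ω * e' (θ' ω) ∂m ∂haar := by
        refine lintegral_congr fun k => ?_
        rw [← (ha.map k).lintegral_comp
          (f := fun ω => e (k⁻¹ * θ ω) * F ω * e' (θ' ω)) (by fun_prop)]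
        refine lintegral_congr_ae ?_
        filter_upwards [eθ k, eθ' k, eF k] with ω h1 h2 h3
        rw [h1, h2, h3, inv_mul_cancel_left]
    _ = ∫⁻ ω, ∫⁻ k, e (k⁻¹ * θ ω) * F ω * e' (θ' ω) ∂haar ∂m :=
        lintegral_lintegral_swap meas2.aemeasurable
    _ = (haar : Measure K) E * ∫⁻ ω, e' (θ' ω) * F ω ∂m := by
        rw [mul_comm, ← lintegral_mul_const _ (by fun_prop)]
        refine lintegral_congr fun ω => ?_
        rw [lintegral_mul_const _ (by fun_prop), lintegral_mul_const _ (by fun_prop), int_inv]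
        ring

/-! ### Borel fundamental domains of lattices -/

section Domain

variable {G : Type u} [Group G] [TopologicalSpace G] [IsTopologicalGroup G]
  [LocallyCompactSpace G] [SecondCountableTopology G]
  [MeasurableSpace G] [BorelSpace G] {Γ : Subgroup G}

theorem Subgroup.countable_of_discrete (Γ : Subgroup G) [DiscreteTopology Γ] :
    Countable Γ := countable_of_Lindelof_of_discrete

/-- A Borel map `Θ : G → Γ` with `Θ(gγ) = γ⁻¹ Θ(g)`. It encodes the Borel fundamental domain
`{Θ = 1}` for the right action of `Γ`: the representative of `gΓ` is `g Θ(g)`. -/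
structure IsDomainCoord (Γ : Subgroup G) (Θ : G → Γ) : Prop where
  measurable : Measurable Θ
  equivariant : ∀ (g : G) (γ : Γ), Θ (g * γ) = γ⁻¹ * Θ g

/-- A neighbourhood of `1` that meets every left coset of the discrete subgroup `Γ` at most once. -/
theorem exists_separating_open (Γ : Subgroup G) [DiscreteTopology Γ] :
    ∃ U : Set G, IsOpen U ∧ (1 : G) ∈ U ∧ ∀ a ∈ U, ∀ b ∈ U, a⁻¹ * b ∈ Γ → a⁻¹ * b = 1 := by
  obtain ⟨V, hV, hV1⟩ := (isOpen_induced_iff).1 (isOpen_discrete ({1} : Set Γ))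
  have h1V : (1 : G) ∈ V := by
    have : (1 : Γ) ∈ (Subtype.val ⁻¹' V : Set Γ) := by rw [hV1]; rfl
    exact this
  have hc : Continuous fun p : G × G => p.1⁻¹ * p.2 := by fun_prop
  have hn : (fun p : G × G => p.1⁻¹ * p.2) ⁻¹' V ∈ nhds ((1 : G), (1 : G)) :=
    (hV.preimage hc).mem_nhds (by simpa using h1V)
  obtain ⟨u, hu, v, hv, huv⟩ := mem_nhds_prod_iff.1 hn
  obtain ⟨U, hUs, hUo, hU1⟩ := mem_nhds_iff.1 (Filter.inter_mem hu hv)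
  refine ⟨U, hUo, hU1, fun a ha b hb hab => ?_⟩
  have h2 : a⁻¹ * b ∈ V := huv (Set.mk_mem_prod (hUs ha).1 (hUs hb).2)
  have h3 : (⟨a⁻¹ * b, hab⟩ : Γ) ∈ (Subtype.val ⁻¹' V : Set Γ) := h2
  rw [hV1] at h3
  exact congrArg Subtype.val h3

/-- Countably many open sets that meet every coset at most once cover `G`; the representative of a
coset is chosen in the first of them that the coset meets. -/
theorem exists_isDomainCoord (Γ : Subgroup G) [DiscreteTopology Γ] :
    ∃ Θ : G → Γ, IsDomainCoord Γ Θ := by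
  classical
  have := Γ.countable_of_discrete
  obtain ⟨U, hUo, hU1, hU⟩ := exists_separating_open Γ
  let d : ℕ → G := TopologicalSpace.denseSeq G
  -- the translates `W n` of `U` cover `G`, and meet every coset of `Γ` at most once
  let W : ℕ → Set G := fun n => {g | (d n)⁻¹ * g ∈ U}
  let S : ℕ → Set G := fun n => {g | ∃ γ : Γ, g * γ ∈ W n}
  have hWo : ∀ n, IsOpen (W n) := fun n => hUo.preimage (by fun_prop)
  have hSm : ∀ n, MeasurableSet (S n) := fun n => by
    have : S n = ⋃ γ : Γ, (fun g : G => g * γ) ⁻¹' W n := by ext; simp [S]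
    rw [this]
    exact (isOpen_iUnion fun γ => (hWo n).preimage (by fun_prop)).measurableSet
  have hcov : ∀ g, ∃ n, g ∈ S n := fun g => by
    have ho : IsOpen {x : G | x⁻¹ * g ∈ U} := hUo.preimage (by fun_prop)
    obtain ⟨n, hx⟩ := (TopologicalSpace.denseRange_denseSeq G).exists_mem_open ho
      ⟨g, by simpa using hU1⟩
    exact ⟨n, 1, by simpa [W, d] using hx⟩
  have huniq : ∀ n (g : G) (γ δ : Γ), g * γ ∈ W n → g * δ ∈ W n → γ = δ := fun n g γ δ h1 h2 => by
    have h3 : ((d n)⁻¹ * (g * γ))⁻¹ * ((d n)⁻¹ * (g * δ)) = (γ : G)⁻¹ * δ := by group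
    have := hU _ h1 _ h2 (by rw [h3]; exact Γ.mul_mem (Γ.inv_mem γ.2) δ.2)
    rw [h3, inv_mul_eq_one] at this
    exact Subtype.ext this
  have hSinv : ∀ n (g : G) (γ : Γ), g * γ ∈ S n ↔ g ∈ S n := fun n g γ => by
    constructor
    · rintro ⟨δ, hδ⟩
      exact ⟨γ * δ, by simpa [mul_assoc] using hδ⟩
    · rintro ⟨δ, hδ⟩
      exact ⟨γ⁻¹ * δ, by simpa [mul_assoc] using hδ⟩
  let N : G → ℕ := fun g => Nat.find (hcov g)
  have hN : ∀ g, g ∈ S (N g) := fun g => Nat.find_spec (hcov g)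
  let Θ : G → Γ := fun g => (hN g).choose
  have hΘ : ∀ g, g * Θ g ∈ W (N g) := fun g => (hN g).choose_spec
  have hNinv : ∀ (g : G) (γ : Γ), N (g * γ) = N g := fun g γ => by
    simp only [N, hSinv]
  refine ⟨Θ, ?_, fun g γ => ?_⟩
  · refine measurable_to_countable' fun γ => ?_
    have : Θ ⁻¹' {γ} = ⋃ n, ((S n ∩ ⋂ k ∈ Set.Iio n, (S k)ᶜ) ∩ {g | g * γ ∈ W n}) := by
      ext g
      simp only [Set.mem_preimage, Set.mem_singleton_iff, Set.mem_iUnion, Set.mem_inter_iff,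
        Set.mem_iInter, Set.mem_Iio, Set.mem_compl_iff, Set.mem_ofPred_eq]
      constructor
      · rintro rfl
        exact ⟨N g, ⟨hN g, fun k hk => Nat.find_min (hcov g) hk⟩, hΘ g⟩
      · rintro ⟨n, ⟨h1, h2⟩, h3⟩
        have hn : N g = n := (Nat.find_eq_iff (hcov g)).2 ⟨h1, h2⟩
        exact huniq n g _ _ (hn ▸ hΘ g) h3
    rw [this]
    refine MeasurableSet.iUnion fun n => ((hSm n).inter ?_).inter ?_
    · exact MeasurableSet.biInter (Set.to_countable _) fun k _ => (hSm k).compl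
    · exact ((hWo n).preimage (by fun_prop)).measurableSet
  · apply huniq (N g) (g * γ)
    · rw [← hNinv g γ]; exact hΘ _
    · simpa [mul_assoc] using hΘ g

namespace IsDomainCoord

variable {Θ : G → Γ}

theorem apply_mul_self (hΘ : IsDomainCoord Γ Θ) (g : G) : Θ (g * Θ g) = 1 := by
  rw [hΘ.equivariant, inv_mul_cancel]

theorem apply_mul_inv (hΘ : IsDomainCoord Γ Θ) (g : G) (γ : Γ) : Θ (g * (γ : G)⁻¹) = γ * Θ g := by
  simpa using hΘ.equivariant g γ⁻¹

/-- The fundamental domain of a lattice has finite Haar measure: the invariant probability measure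
`μ` on `G ⧸ Γ` lifts to the Haar measure `A ↦ ∫ #{γ | gγ ∈ A} dμ(gΓ)`, which gives mass one to the
domain, and Haar measures are unique up to scaling. -/
theorem haar_lt_top [T2Space G] [IsLattice Γ] (hΘ : IsDomainCoord Γ Θ) :
    (haar : Measure G) (Θ ⁻¹' {1}) < ∞ := by
  have := Γ.countable_of_discrete
  obtain ⟨μ, hμ, hμG⟩ := IsLattice.exists_invariant (Γ := Γ)
  have hs : ∀ a b : G, QuotientGroup.leftRel Γ a b → a * Θ a = b * Θ b := by
    intro a b hab
    rw [QuotientGroup.leftRel_apply] at hab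
    have := hΘ.equivariant a ⟨_, hab⟩
    simp only [mul_inv_cancel_left] at this
    rw [this]
    simp [mul_assoc]
  let s : G ⧸ Γ → G := Quotient.lift (fun g => g * Θ g) hs
  have hsmk : ∀ g : G, s (g : G ⧸ Γ) = g * Θ g := fun g => rfl
  have hsm : Measurable s := by
    refine measurable_from_quotient.2 ?_
    exact measurable_id.mul (measurable_subtype_coe.comp hΘ.measurable)
  -- `lam` is the lift of `μ` to `G`, computed by summing over the fibres of `G → G ⧸ Γ`
  let N : (G → ℝ≥0∞) → G → ℝ≥0∞ := fun f g => ∑' γ : Γ, f (g * γ)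
  have hN : ∀ f g (γ : Γ), N f (g * γ) = N f g := fun f g γ => by
    simp only [N, mul_assoc]
    exact (Equiv.mulLeft γ).tsum_eq (fun δ : Γ => f (g * δ))
  let lam : Measure G := Measure.sum fun γ : Γ => μ.map (fun x => s x * γ)
  have hlam : ∀ f : G → ℝ≥0∞, Measurable f → ∫⁻ g, f g ∂lam = ∫⁻ x, N f (s x) ∂μ := by
    intro f hf
    rw [lintegral_sum_measure, lintegral_tsum fun γ => by fun_prop]
    exact tsum_congr fun γ => lintegral_map hf (by fun_prop)
  have hsmul : ∀ g : G, MeasurePreserving (fun x : G ⧸ Γ => g • x) μ μ := fun g => by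
    have hm : Measurable (fun x : G ⧸ Γ => g • x) := by
      refine measurable_from_quotient.2 ?_
      exact measurable_quotient_mk''.comp (measurable_const_mul g)
    refine ⟨hm, Measure.ext fun A hA => ?_⟩
    rw [Measure.map_apply hm hA]
    exact hμG.measure_preimage_smul g hA
  have hleft : lam.IsMulLeftInvariant := by
    refine ⟨fun g => Measure.ext_of_lintegral _ fun f hf => ?_⟩
    rw [lintegral_map hf (measurable_const_mul g), hlam _ (by fun_prop), hlam f hf]
    have h1 : Measurable fun x => N f (s x) := Measurable.tsum fun γ => by fun_prop
    rw [← (hsmul g).lintegral_comp h1]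
    refine lintegral_congr fun x => ?_
    induction x using QuotientGroup.induction_on with
    | H h =>
      have : N (fun y => f (g * y)) (s h) = N f (g * s h) := by simp only [N, mul_assoc]
      rw [this]
      change N f (g * (h * Θ h)) = N f (s ((g * h : G) : G ⧸ Γ))
      rw [hsmk, hN, ← mul_assoc, hN]
  have hD : lam (Θ ⁻¹' {1}) = 1 := by
    have hm : MeasurableSet (Θ ⁻¹' {1}) := hΘ.measurable (measurableSet_singleton _)
    rw [← lintegral_indicator_one hm, hlam _ (measurable_one.indicator hm)]
    have : ∀ x, N ((Θ ⁻¹' {1}).indicator 1) (s x) = 1 := fun x => by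
      induction x using QuotientGroup.induction_on with
      | H h =>
        rw [hsmk, hN]
        simp only [N]
        rw [tsum_eq_single (Θ h)]
        · simp [Set.indicator, hΘ.apply_mul_self]
        · intro γ hγ
          have : Θ (h * γ) ≠ 1 := by
            rw [hΘ.equivariant, ne_eq, inv_mul_eq_one]; exact hγ
          simp [Set.indicator, this]
    simp [this]
  obtain ⟨U, hUo, hU1, hU⟩ := exists_separating_open Γ
  -- `lam` is a Haar measure: a small compact neighbourhood of `1` has finite positive measure
  obtain ⟨K, hK, hKn, hKU⟩ := exists_compact_subset hUo hU1
  have hKle : lam K ≤ 1 := by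
    have hm : MeasurableSet K := hK.isClosed.measurableSet
    rw [← lintegral_indicator_one hm, hlam _ (measurable_one.indicator hm)]
    have : ∀ g, N (K.indicator 1) g ≤ 1 := fun g => by
      by_cases h : ∃ δ : Γ, g * δ ∈ K
      · obtain ⟨δ, hδ⟩ := h
        simp only [N]
        rw [tsum_eq_single δ]
        · simp [hδ]
        · intro γ hγ
          have : g * γ ∉ K := fun hγK => hγ <| by
            have h3 : (g * δ)⁻¹ * (g * γ) = (δ : G)⁻¹ * γ := by group
            have h4 := hU _ (hKU hδ) _ (hKU hγK) (by
              rw [h3]; exact Γ.mul_mem (Γ.inv_mem δ.2) γ.2)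
            rw [h3, inv_mul_eq_one] at h4
            exact (Subtype.ext h4).symm
          simp [this]
      · push Not at h
        simp [N, h]
    calc _ ≤ ∫⁻ _, 1 ∂μ := lintegral_mono fun x => this _
      _ = 1 := by simp
  have hKne : lam K ≠ 0 := by
    intro h0
    have hcov : ∃ t : Set G, t.Countable ∧ ⋃ g ∈ t, g • K = Set.univ := by
      refine TopologicalSpace.countable_cover_nhds fun g => ?_
      have := smul_mem_nhds_smul g (mem_interior_iff_mem_nhds.1 hKn)
      simpa using this
    obtain ⟨t, ht, htu⟩ := hcov
    have : lam Set.univ = 0 := by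
      rw [← htu]
      refine (measure_biUnion_null_iff ht).2 fun g _ => ?_
      rw [measure_smul, h0]
    rw [measure_mono_null (Set.subset_univ _) this] at hD
    exact zero_ne_one hD
  have hH : lam.IsHaarMeasure :=
    isHaarMeasure_of_isCompact_nonempty_interior lam K hK ⟨1, hKn⟩ hKne
      (hKle.trans_lt ENNReal.one_lt_top).ne
  rw [isMulLeftInvariant_eq_smul (haar : Measure G) lam, Measure.smul_apply, hD]
  simp

/-- The fundamental domain `{Θ = 1}`. -/
def Dom (_hΘ : IsDomainCoord Γ Θ) : Type u := {g : G // Θ g = 1}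

variable (hΘ : IsDomainCoord Γ Θ)

instance : MeasurableSpace hΘ.Dom := inferInstanceAs (MeasurableSpace {g : G // Θ g = 1})

/-- The inclusion of the fundamental domain into the group. -/
def incl (d : hΘ.Dom) : G := d.1

theorem measurable_incl : Measurable hΘ.incl := measurable_subtype_coe

theorem apply_incl (d : hΘ.Dom) : Θ (hΘ.incl d) = 1 := d.2

/-- The point `g Θ(g)` of the fundamental domain in the coset `gΓ`. -/
def rep (g : G) : hΘ.Dom := ⟨g * Θ g, hΘ.apply_mul_self g⟩

theorem incl_rep (g : G) : hΘ.incl (hΘ.rep g) = g * Θ g := rfl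

theorem incl_injective : Function.Injective hΘ.incl := Subtype.val_injective

theorem measurable_rep : Measurable hΘ.rep :=
  (measurable_id.mul (measurable_subtype_coe.comp hΘ.measurable)).subtype_mk

theorem rep_incl_mul (d : hΘ.Dom) (γ : Γ) : hΘ.rep (hΘ.incl d * γ) = d := by
  apply hΘ.incl_injective
  rw [incl_rep, hΘ.equivariant, hΘ.apply_incl]
  simp

theorem rep_incl (d : hΘ.Dom) : hΘ.rep (hΘ.incl d) = d := by
  simpa using hΘ.rep_incl_mul d 1

theorem rep_mul (g : G) (γ : Γ) : hΘ.rep (g * γ) = hΘ.rep g := by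
  apply hΘ.incl_injective
  rw [incl_rep, hΘ.equivariant, incl_rep]
  simp [mul_assoc]

/-- The action of `G` on the fundamental domain, transported from `G ⧸ Γ`. -/
instance : MulAction G hΘ.Dom where
  smul g d := hΘ.rep (g * hΘ.incl d)
  one_smul d := by
    change hΘ.rep (1 * hΘ.incl d) = d
    rw [one_mul, rep_incl]
  mul_smul g h d := by
    change hΘ.rep (g * h * hΘ.incl d) = hΘ.rep (g * hΘ.incl (hΘ.rep (h * hΘ.incl d)))
    rw [incl_rep, ← mul_assoc, rep_mul, mul_assoc]

theorem smul_def (g : G) (d : hΘ.Dom) : g • d = hΘ.rep (g * hΘ.incl d) := rfl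

/-- The cocycle `G × D → Γ` of the fundamental domain: `g d = (g • d) coc(g, d)` in `G`. -/
def coc (g : G) (d : hΘ.Dom) : Γ := (Θ (g * hΘ.incl d))⁻¹

theorem incl_smul (g : G) (d : hΘ.Dom) :
    hΘ.incl (g • d) = g * hΘ.incl d * (hΘ.coc g d : G)⁻¹ := by
  rw [smul_def, incl_rep, coc]
  simp

theorem coc_mul (g h : G) (d : hΘ.Dom) :
    hΘ.coc (g * h) d = hΘ.coc g (h • d) * hΘ.coc h d := by
  rw [coc, coc, incl_smul, ← mul_assoc, ← mul_assoc, hΘ.apply_mul_inv]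
  simp

theorem coc_one (d : hΘ.Dom) : hΘ.coc 1 d = 1 := by
  rw [coc, one_mul, hΘ.apply_incl, inv_one]

theorem measurable_coc : Measurable fun p : G × hΘ.Dom => hΘ.coc p.1 p.2 :=
  (hΘ.measurable.comp (measurable_fst.mul (hΘ.measurable_incl.comp measurable_snd))).inv

instance : MeasurableSMul₂ G hΘ.Dom :=
  ⟨hΘ.measurable_rep.comp (measurable_fst.mul (hΘ.measurable_incl.comp measurable_snd))⟩

instance [T2Space G] : StandardBorelSpace hΘ.Dom :=
  have := standardBorelSpace_of_lcsc G
  (hΘ.measurable (measurableSet_singleton _) : MeasurableSet (Θ ⁻¹' {1})).standardBorel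

section Volume

variable [DiscreteTopology Γ]

/-- The restriction of the Haar measure of `G` to the fundamental domain, normalized so that
`G ≅ D × Γ` preserves Haar measures. -/
noncomputable def vol : Measure hΘ.Dom :=
  (haarPoint Γ)⁻¹ • (haar : Measure G).comap hΘ.incl

theorem lintegral_vol [T2Space G] (f : G → ℝ≥0∞) :
    ∫⁻ d, f (hΘ.incl d) ∂hΘ.vol = (haarPoint Γ)⁻¹ * ∫⁻ g in Θ ⁻¹' {1}, f g ∂haar := by
  rw [vol, lintegral_smul_measure, smul_eq_mul]
  congr 1
  exact lintegral_subtype_comap (hΘ.measurable (measurableSet_singleton _)) f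

instance [T2Space G] [IsLattice Γ] : IsFiniteMeasure hΘ.vol := by
  refine ⟨?_⟩
  have := hΘ.lintegral_vol (fun _ => 1)
  rw [lintegral_one, setLIntegral_one] at this
  rw [this]
  exact ENNReal.mul_lt_top (ENNReal.inv_lt_top.2 (haarPoint_ne_zero Γ).bot_lt) hΘ.haar_lt_top

/-- Integration over `G` unfolds to integration over the fundamental domain. -/
theorem lintegral_tsum_dom (hΘ : IsDomainCoord Γ Θ) [T2Space G]
    [(haar : Measure G).IsMulRightInvariant] {f : G → ℝ≥0∞} (hf : Measurable f) :
    ∫⁻ g in Θ ⁻¹' {1}, ∑' γ : Γ, f (g * γ) ∂haar = ∫⁻ g, f g ∂haar := by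
  have := Γ.countable_of_discrete
  have hm : MeasurableSet (Θ ⁻¹' {1}) := hΘ.measurable (measurableSet_singleton _)
  have hi : Measurable ((Θ ⁻¹' {1}).indicator (1 : G → ℝ≥0∞)) := measurable_one.indicator hm
  rw [lintegral_tsum fun γ => by fun_prop]
  calc ∑' γ : Γ, ∫⁻ g in Θ ⁻¹' {1}, f (g * γ) ∂haar
      = ∑' γ : Γ, ∫⁻ g, (Θ ⁻¹' {1}).indicator 1 (g * (γ : G)⁻¹) * f g ∂haar := by
        refine tsum_congr fun γ => ?_
        rw [← lintegral_indicator hm, ← lintegral_mul_right_eq_self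
          (fun g => (Θ ⁻¹' {1}).indicator 1 (g * (γ : G)⁻¹) * f g) (γ : G)]
        refine lintegral_congr fun g => ?_
        by_cases h : Θ g = 1 <;> simp [Set.indicator, h]
    _ = ∫⁻ g, ∑' γ : Γ, (Θ ⁻¹' {1}).indicator 1 (g * (γ : G)⁻¹) * f g ∂haar :=
        (lintegral_tsum fun γ => by fun_prop).symm
    _ = ∫⁻ g, f g ∂haar := by
        refine lintegral_congr fun g => ?_
        rw [tsum_eq_single (Θ g)⁻¹]
        · simp [Set.indicator, hΘ.apply_mul_self]
        · intro γ hγ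
          have : Θ (g * (γ : G)⁻¹) ≠ 1 := by
            rw [hΘ.apply_mul_inv, ne_eq, mul_eq_one_iff_eq_inv]; exact hγ
          simp [Set.indicator, this]

theorem measurePreserving_mul [T2Space G] [(haar : Measure G).IsMulRightInvariant]
    [IsLattice Γ] :
    MeasurePreserving (fun p : hΘ.Dom × Γ => hΘ.incl p.1 * p.2) (hΘ.vol.prod haar) haar := by
  have := Γ.countable_of_discrete
  have hm : Measurable (fun p : hΘ.Dom × Γ => hΘ.incl p.1 * p.2) :=
    (hΘ.measurable_incl.comp measurable_fst).mul (measurable_subtype_coe.comp measurable_snd)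
  refine ⟨hm, Measure.ext_of_lintegral _ fun f hf => ?_⟩
  rw [lintegral_map hf hm, lintegral_prod
    (fun p : hΘ.Dom × Γ => f (hΘ.incl p.1 * p.2)) (hf.comp hm).aemeasurable]
  simp only [lintegral_haar_discrete]
  rw [hΘ.lintegral_vol (fun g => haarPoint Γ * ∑' γ : Γ, f (g * γ)),
    lintegral_const_mul _ (Measurable.tsum fun γ => by fun_prop),
    hΘ.lintegral_tsum_dom hf, ← mul_assoc,
    ENNReal.inv_mul_cancel (haarPoint_ne_zero Γ) (haarPoint_ne_top Γ), one_mul]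

theorem measurePreserving_rep [T2Space G] [(haar : Measure G).IsMulRightInvariant]
    [IsLattice Γ] :
    MeasurePreserving (fun g => (hΘ.rep g, (Θ g)⁻¹)) haar (hΘ.vol.prod (haar : Measure Γ)) := by
  have hm : Measurable (fun g => (hΘ.rep g, (Θ g)⁻¹)) :=
    hΘ.measurable_rep.prodMk hΘ.measurable.inv
  refine ⟨hm, ?_⟩
  have h := hΘ.measurePreserving_mul
  rw [← h.map_eq, Measure.map_map hm h.measurable]
  convert Measure.map_id
  ext1 p
  simp [rep_incl_mul, hΘ.equivariant, hΘ.apply_incl]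

theorem _root_.isMPAction_mul_inv (Γ : Subgroup G) [(haar : Measure G).IsMulRightInvariant] :
    IsMPAction (fun (γ : Γ) (x : G) => x * (γ : G)⁻¹) (haar : Measure G) where
  measurable := measurable_snd.mul (measurable_subtype_coe.comp measurable_fst).inv
  one := by simp
  mul := by simp [mul_assoc]
  map γ := measurePreserving_mul_right _ _

theorem measurePreserving_smul [T2Space G] [(haar : Measure G).IsMulRightInvariant] (g : G) :
    MeasurePreserving (fun d : hΘ.Dom => g • d) hΘ.vol hΘ.vol := by
  have := Γ.countable_of_discrete
  have := haar_isMulRightInvariant_of_discrete Γ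
  have hm : Measurable (fun d : hΘ.Dom => g • d) :=
    hΘ.measurable_rep.comp (measurable_const.mul hΘ.measurable_incl)
  refine ⟨hm, Measure.ext_of_lintegral _ fun f hf => ?_⟩
  rw [lintegral_map hf hm]
  have hfr : Measurable fun x => f (hΘ.rep x) := hf.comp hΘ.measurable_rep
  -- `{Θ = 1}` and its translate `{x | Θ(g x) = 1}` are fundamental domains of the same action
  have key := mass_transport (isMPAction_mul_inv Γ) hΘ.measurable
    (hΘ.measurable.comp (measurable_const_mul g))
    (fun γ => .of_forall fun x => hΘ.apply_mul_inv x γ)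
    (fun γ => .of_forall fun x => by
      simp only [Function.comp, ← mul_assoc, hΘ.apply_mul_inv])
    (F := fun x => f (hΘ.rep (g * x))) (hfr.comp (measurable_const_mul g))
    (fun γ => .of_forall fun x => by
      have := hΘ.rep_mul (g * x) γ⁻¹
      simp only [Subgroup.coe_inv] at this
      simp only [← mul_assoc, this])
    (measurableSet_singleton (1 : Γ)) (measurableSet_singleton (1 : Γ))
  change haarPoint Γ * _ = haarPoint Γ * _ at key
  rw [ENNReal.mul_right_inj (haarPoint_ne_zero Γ) (haarPoint_ne_top Γ)] at key
  have h1 : ∫⁻ d, f (g • d) ∂hΘ.vol = ∫⁻ d, f (hΘ.rep (g * hΘ.incl d)) ∂hΘ.vol := rfl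
  have h2 : ∫⁻ d, f d ∂hΘ.vol = ∫⁻ d, f (hΘ.rep (hΘ.incl d)) ∂hΘ.vol := by simp only [rep_incl]
  rw [h1, h2, hΘ.lintegral_vol (fun x => f (hΘ.rep (g * x))),
    hΘ.lintegral_vol (fun x => f (hΘ.rep x)), key]
  congr 1
  have hm : MeasurableSet (Θ ⁻¹' {1}) := hΘ.measurable (measurableSet_singleton _)
  rw [← lintegral_indicator hm, Set.preimage_comp,
    ← lintegral_indicator (measurable_const_mul g hm), ← lintegral_mul_left_eq_self
      (fun x => (Θ ⁻¹' {1}).indicator (fun x => f (hΘ.rep x)) x) g]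
  rfl

theorem vol_ne_zero [T2Space G] [(haar : Measure G).IsMulRightInvariant] : hΘ.vol ≠ 0 := by
  intro h
  have h1 := hΘ.lintegral_vol (fun _ => ∑' _ : Γ, 1)
  rw [h, lintegral_zero_measure, hΘ.lintegral_tsum_dom (f := fun _ => 1) measurable_const] at h1
  simp only [lintegral_const, one_mul, zero_eq_mul, ENNReal.inv_eq_zero, haarPoint_ne_top,
    false_or, Measure.measure_univ_eq_zero] at h1
  exact NeZero.ne (haar : Measure G) h1

end Volume

end IsDomainCoord
end Domain

/-! ### Word norms -/

section WordNorm

variable {K : Type u} [Group K] [TopologicalSpace K] {S : Set K}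

theorem mem_pow_wordNorm (hS : IsCompactGenerating S) (g : K) : g ∈ S ^ wordNorm S g := by
  have hex : ∃ n, g ∈ S ^ n := by
    have hg : g ∈ Subgroup.closure S := by rw [hS.2.2]; trivial
    induction hg using Subgroup.closure_induction with
    | mem x hx => exact ⟨1, by simpa using hx⟩
    | one => exact ⟨0, by simp⟩
    | mul x y _ _ hx hy =>
      obtain ⟨n, hn⟩ := hx
      obtain ⟨k, hk⟩ := hy
      exact ⟨n + k, by rw [pow_add]; exact Set.mul_mem_mul hn hk⟩
    | inv x _ hx =>
      obtain ⟨n, hn⟩ := hx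
      refine ⟨n, ?_⟩
      rw [← hS.2.1, inv_pow]
      simpa using hn
  exact Nat.sInf_mem (s := {n : ℕ | g ∈ S ^ n}) hex

theorem wordNorm_le {g : K} {n : ℕ} (h : g ∈ S ^ n) : wordNorm S g ≤ n := Nat.sInf_le h

theorem wordNorm_one : wordNorm S (1 : K) = 0 := Nat.le_zero.1 (wordNorm_le (by simp))

theorem wordNorm_mul_le (hS : IsCompactGenerating S) (g h : K) :
    wordNorm S (g * h) ≤ wordNorm S g + wordNorm S h := by
  apply wordNorm_le
  rw [pow_add]
  exact Set.mul_mem_mul (mem_pow_wordNorm hS g) (mem_pow_wordNorm hS h)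

theorem wordNorm_inv (hS : IsCompactGenerating S) (g : K) : wordNorm S g⁻¹ = wordNorm S g := by
  have key : ∀ g : K, wordNorm S g⁻¹ ≤ wordNorm S g := fun g => by
    apply wordNorm_le
    have h := mem_pow_wordNorm hS g
    rwa [← Set.inv_mem_inv, ← inv_pow, hS.2.1] at h
  exact (key g).antisymm (by simpa using key g⁻¹)

theorem measurable_wordNorm [IsTopologicalGroup K] [T2Space K] [MeasurableSpace K] [BorelSpace K]
    (hS : IsCompactGenerating S) : Measurable (wordNorm S) := by
  refine measurable_of_Iic fun n => ?_
  have : wordNorm S ⁻¹' Set.Iic n = ⋃ k ∈ Set.Iic n, S ^ k := by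
    ext g
    simp only [Set.mem_preimage, Set.mem_Iic, Set.mem_iUnion, exists_prop]
    exact ⟨fun h => ⟨_, h, mem_pow_wordNorm hS g⟩, fun ⟨k, hk, h⟩ => (wordNorm_le h).trans hk⟩
  rw [this]
  refine MeasurableSet.biUnion (Set.to_countable _) fun k _ => ?_
  have hc : ∀ k : ℕ, IsCompact (S ^ k) := fun k => by
    induction k with
    | zero => simp
    | succ k ih => rw [pow_succ]; exact ih.mul hS.1
  exact (hc k).isClosed.measurableSet

/-- A subadditive function that is bounded by `M` on the generating set is bounded by `M` times
the word norm. -/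
theorem le_mul_wordNorm (hS : IsCompactGenerating S) {q : K → ℝ≥0∞} (q_one : q 1 = 0)
    (q_mul : ∀ g h, q (g * h) ≤ q g + q h) {M : ℝ≥0∞} (hM : ∀ s ∈ S, q s ≤ M) (g : K) :
    q g ≤ M * wordNorm S g := by
  have key : ∀ n : ℕ, ∀ g ∈ S ^ n, q g ≤ M * n := by
    intro n
    induction n with
    | zero =>
      intro g hg
      rw [pow_zero, Set.mem_one] at hg
      simp [hg, q_one]
    | succ n ih =>
      intro g hg
      rw [pow_succ] at hg
      obtain ⟨a, ha, s, hs, rfl⟩ := hg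
      calc q (a * s) ≤ q a + q s := q_mul a s
        _ ≤ M * n + M := add_le_add (ih a ha) (hM s hs)
        _ = M * (n + 1 : ℕ) := by push_cast; ring
  exact key _ g (mem_pow_wordNorm hS g)

/-- A measurable subadditive symmetric function that is almost everywhere finite is bounded on
compact sets. By Steinhaus' theorem it is bounded near `1`. -/
theorem exists_bound_of_subadditive {L : Type u} [Group L] [TopologicalSpace L]
    [IsTopologicalGroup L] [LocallyCompactSpace L] [SecondCountableTopology L]
    [MeasurableSpace L] [BorelSpace L] {q : L → ℝ≥0∞} (hq : Measurable q)
    (q_mul : ∀ g h, q (g * h) ≤ q g + q h) (q_inv : ∀ g, q g⁻¹ = q g)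
    (hfin : ∀ᵐ g ∂(haar : Measure L), q g < ∞) {T : Set L} (hT : IsCompact T) :
    ∃ M : ℝ≥0∞, M ≠ ∞ ∧ ∀ t ∈ T, q t ≤ M := by
  obtain ⟨n, hn⟩ : ∃ n : ℕ, (haar : Measure L) {g | q g ≤ n} ≠ 0 := by
    by_contra! h
    have h1 : ∀ᵐ g ∂(haar : Measure L), ∀ n : ℕ, ¬ q g ≤ n := by
      rw [ae_all_iff]
      intro n
      rw [ae_iff]
      simpa using h n
    have h2 : ∀ᵐ g ∂(haar : Measure L), False := by
      filter_upwards [hfin, h1] with g h3 h4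
      obtain ⟨n, hn⟩ := ENNReal.exists_nat_gt h3.ne
      exact h4 n hn.le
    have h3 : (haar : Measure L) = 0 := by simpa [ae_iff] using h2
    exact NeZero.ne (haar : Measure L) h3
  let V : Set L := {g | q g ≤ n} / {g | q g ≤ n}
  have hV : V ∈ nhds 1 := div_mem_nhds_one_of_haar_pos haar _
    (measurableSet_le hq measurable_const) (pos_iff_ne_zero.2 hn)
  have hVq : ∀ v ∈ V, q v ≤ n + n := by
    rintro _ ⟨a, ha, b, hb, rfl⟩
    change q (a / b) ≤ _
    rw [div_eq_mul_inv]
    exact (q_mul _ _).trans (add_le_add ha ((q_inv b).trans_le hb))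
  -- `q` is finite on a conull, hence dense, set; so it is finite everywhere
  have hdense : Dense {g : L | q g < ∞} := dense_of_ae hfin
  have hall : ∀ g, q g < ∞ := fun g => by
    have hn : {x : L | x⁻¹ * g ∈ V} ∈ nhds g := by
      have hc : Continuous fun x : L => x⁻¹ * g := by fun_prop
      exact hc.continuousAt.preimage_mem_nhds (by simpa using hV)
    obtain ⟨x, hx, hxq⟩ := hdense.inter_nhds_nonempty hn
    have := q_mul x (x⁻¹ * g)
    rw [mul_inv_cancel_left] at this
    exact this.trans_lt (ENNReal.add_lt_top.2 ⟨hx, (hVq _ hxq).trans_lt (by simp)⟩)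
  obtain ⟨F, -, hF⟩ := hT.elim_nhds_subcover (fun t => t • V) fun t _ => by
    simpa using smul_mem_nhds_smul t hV
  refine ⟨(∑ t ∈ F, q t) + (n + n), ?_, fun t ht => ?_⟩
  · exact (ENNReal.add_lt_top.2 ⟨ENNReal.sum_lt_top.2 fun t _ => hall t, by simp⟩).ne
  · obtain ⟨s, hs, v, hv, rfl⟩ := Set.mem_iUnion₂.1 (hF ht)
    exact (q_mul s v).trans (add_le_add (Finset.single_le_sum (f := q) (by simp) hs) (hVq v hv))

end WordNorm

/-! ### Fundamental isomorphisms and their cocycles -/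

section Iso

variable {K : Type u} [Group K] [TopologicalSpace K] [IsTopologicalGroup K]
  [LocallyCompactSpace K] [SecondCountableTopology K] [T2Space K] [MeasurableSpace K] [BorelSpace K]
  {Ω : Type u} [MeasurableSpace Ω] {a : K → Ω → Ω} {m : Measure Ω}
  {Y : Type u} [MeasurableSpace Y] {ν : Measure Y}

namespace MeasEquiv.FundamentalIso

theorem measurePreserving_invFun (i : FundamentalIso K a m Y ν) :
    MeasurePreserving i.invFun m ((haar : Measure K).prod ν) := by
  refine ⟨i.measurable_invFun, ?_⟩
  refine (congrArg (Measure.map i.invFun) i.measurePreserving_toFun.map_eq.symm).trans ?_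
  rw [Measure.map_map i.measurable_invFun i.measurePreserving_toFun.measurable]
  exact (Measure.map_congr i.left_inv).trans Measure.map_id

theorem ae_of_ae_comp (i : FundamentalIso K a m Y ν) {P : Ω → Prop}
    (h : ∀ᵐ p ∂((haar : Measure K).prod ν), P (i.toFun p)) : ∀ᵐ ω ∂m, P ω := by
  filter_upwards [i.measurePreserving_invFun.quasiMeasurePreserving.ae h, i.right_inv] with ω h1 h2
  rwa [h2] at h1

/-- The `K`-coordinate of a fundamental isomorphism. -/
def coord (i : FundamentalIso K a m Y ν) (ω : Ω) : K := (i.invFun ω).1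

/-- The coordinate of a fundamental isomorphism in the quotient by `K`. -/
def base (i : FundamentalIso K a m Y ν) (ω : Ω) : Y := (i.invFun ω).2

theorem measurable_coord (i : FundamentalIso K a m Y ν) : Measurable i.coord :=
  measurable_fst.comp i.measurable_invFun

theorem measurable_base (i : FundamentalIso K a m Y ν) : Measurable i.base :=
  measurable_snd.comp i.measurable_invFun

theorem ae_invFun_act [SFinite ν] (i : FundamentalIso K a m Y ν) (k : K) :
    ∀ᵐ ω ∂m, i.invFun (a k ω) = (k * (i.invFun ω).1, (i.invFun ω).2) := by
  have hmp : MeasurePreserving (fun p : K × Y => (k * p.1, p.2)) ((haar : Measure K).prod ν)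
      ((haar : Measure K).prod ν) :=
    (measurePreserving_mul_left haar k).prod (MeasurePreserving.id ν)
  apply i.ae_of_ae_comp
  filter_upwards [i.equivariant, i.left_inv, hmp.quasiMeasurePreserving.ae i.left_inv]
    with p h1 h2 h3
  rw [← h1, h3, h2]

theorem coord_act [SFinite ν] (i : FundamentalIso K a m Y ν) (k : K) :
    ∀ᵐ ω ∂m, i.coord (a k ω) = k * i.coord ω :=
  (i.ae_invFun_act k).mono fun _ h => congrArg Prod.fst h

/-- The measure on the base is a multiple of the image of `m` restricted to `{coord ∈ E}`. -/
theorem map_base [SFinite ν] (i : FundamentalIso K a m Y ν) {E : Set K} (hE : MeasurableSet E) :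
    (m.restrict (i.coord ⁻¹' E)).map i.base = (haar : Measure K) E • ν := by
  have h1 := i.measurePreserving_invFun.restrict_preimage (hE.prod (MeasurableSet.univ (α := Y)))
  have h2 : i.coord ⁻¹' E = i.invFun ⁻¹' (E ×ˢ Set.univ) := by ext; simp [coord]
  rw [h2, show i.base = Prod.snd ∘ i.invFun from rfl,
    ← Measure.map_map measurable_snd i.measurable_invFun, h1.map_eq, ← Measure.prod_restrict,
    Measure.restrict_univ, Measure.map_snd_prod, Measure.restrict_apply_univ]

theorem measure_coord_preimage [SFinite ν] (i : FundamentalIso K a m Y ν) {E : Set K}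
    (hE : MeasurableSet E) : m (i.coord ⁻¹' E) = (haar : Measure K) E * ν Set.univ := by
  have := congrArg (fun μ => μ Set.univ) (i.map_base hE)
  simpa [Measure.map_apply i.measurable_base MeasurableSet.univ] using this

end MeasEquiv.FundamentalIso

/-- In terms of the coordinate `θ` of the fundamental isomorphism, the ME-cocycle at the base point
of `ω` is `θ(l ω)⁻¹ θ(ω)`. -/
theorem MeasEquiv.IsMECocycle.ae_eq {L : Type u} [MeasurableSpace L] {b : L → Ω → Ω}
    {i : FundamentalIso K a m Y ν} {c : L × Y → K} (hc : IsMECocycle i b c) (l : L) :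
    ∀ᵐ ω ∂m, c (l, i.base ω) = (i.coord (b l ω))⁻¹ * i.coord ω := by
  apply i.ae_of_ae_comp
  filter_upwards [hc.2 l, i.left_inv] with p h1 h2
  simp only [FundamentalIso.base, FundamentalIso.coord]
  rw [h1, h2]
  simp

variable {L : Type u} [Group L] [TopologicalSpace L] [IsTopologicalGroup L]
  [LocallyCompactSpace L] [SecondCountableTopology L] [T2Space L] [MeasurableSpace L] [BorelSpace L]
  {b : L → Ω → Ω}

/-- The action of `L` commuting with that of `K` preserves the measure on the quotient by `K`: for
a `K`-invariant `F` the distributions of `F` and of `F ∘ l` on `{θ ∈ E}` agree. -/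
theorem map_restrict_comp_act [(haar : Measure K).IsMulRightInvariant] [SFinite m]
    (ha : IsMPAction a m) (hb : IsMPAction b m) (hab : ∀ k l ω, a k (b l ω) = b l (a k ω))
    {θ : Ω → K} (hθ : Measurable θ) (eθ : ∀ k, ∀ᵐ ω ∂m, θ (a k ω) = k * θ ω)
    {E : Set K} (hE : MeasurableSet E) (hE0 : (haar : Measure K) E ≠ 0)
    (hE1 : (haar : Measure K) E ≠ ∞) {Z : Type v} [MeasurableSpace Z] {F : Ω → Z}
    (hF : Measurable F) (eF : ∀ k, ∀ᵐ ω ∂m, F (a k ω) = F ω) (l : L) :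
    (m.restrict (θ ⁻¹' E)).map (fun ω => F (b l ω)) = (m.restrict (θ ⁻¹' E)).map F := by
  have hbl := (hb.map l).measurable
  have hEm : MeasurableSet (θ ⁻¹' E) := hθ hE
  have hFb : Measurable fun ω => F (b l ω) := hF.comp hbl
  refine Measure.ext fun B hB => ?_
  rw [Measure.map_apply hFb hB, Measure.map_apply hF hB,
    Measure.restrict_apply (hFb hB), Measure.restrict_apply (hF hB)]
  have hθ' : Measurable fun ω => θ (b l⁻¹ ω) := hθ.comp (hb.map l⁻¹).measurable
  have key := mass_transport ha hθ' hθ (fun k => by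
      filter_upwards [(hb.map l⁻¹).quasiMeasurePreserving.ae (eθ k)] with ω h
      rw [← hab, h]) eθ (F := (F ⁻¹' B).indicator 1)
    (measurable_one.indicator (hF hB)) (fun k => by
      filter_upwards [eF k] with ω h
      change B.indicator (1 : Z → ℝ≥0∞) (F (a k ω)) = B.indicator 1 (F ω)
      rw [h]) hE hE
  rw [ENNReal.mul_right_inj hE0 hE1, lintegral_indicator_one (hF hB),
    lintegral_indicator_one (hF hB), Measure.restrict_apply (hF hB),
    Measure.restrict_apply (hF hB)] at key
  rw [← key, ← (hb.map l).measure_preimage ((hF hB).inter (hθ' hE)).nullMeasurableSet]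
  congr 1
  ext ω
  simp [hb.inv_self]

theorem eLpNorm_comp_act [(haar : Measure K).IsMulRightInvariant] [SFinite m]
    (ha : IsMPAction a m) (hb : IsMPAction b m) (hab : ∀ k l ω, a k (b l ω) = b l (a k ω))
    {θ : Ω → K} (hθ : Measurable θ) (eθ : ∀ k, ∀ᵐ ω ∂m, θ (a k ω) = k * θ ω)
    {E : Set K} (hE : MeasurableSet E) (hE0 : (haar : Measure K) E ≠ 0)
    (hE1 : (haar : Measure K) E ≠ ∞) (p : ℝ≥0∞) {F : Ω → ℝ} (hF : Measurable F)
    (eF : ∀ k, ∀ᵐ ω ∂m, F (a k ω) = F ω) (l : L) :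
    eLpNorm (fun ω => F (b l ω)) p (m.restrict (θ ⁻¹' E)) =
      eLpNorm F p (m.restrict (θ ⁻¹' E)) := by
  have hFb : Measurable fun ω => F (b l ω) := hF.comp (hb.map l).measurable
  have e1 := eLpNorm_map_measure (p := p) (μ := m.restrict (θ ⁻¹' E))
    (f := fun ω => F (b l ω)) (g := id) aestronglyMeasurable_id hFb.aemeasurable
  have e2 := eLpNorm_map_measure (p := p) (μ := m.restrict (θ ⁻¹' E))
    (f := F) (g := id) aestronglyMeasurable_id hF.aemeasurable
  rw [map_restrict_comp_act ha hb hab hθ eθ hE hE0 hE1 hF eF, e2] at e1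
  exact e1.symm

theorem eLpNormEssSup_le_iff_ae {X : Type u} [MeasurableSpace X] {μ : Measure X} {f : X → ℝ}
    {r : ℝ≥0∞} : eLpNormEssSup f μ ≤ r ↔ ∀ᵐ x ∂μ, ‖f x‖ₑ ≤ r :=
  ⟨fun h => (enorm_ae_le_eLpNormEssSup f μ).mono fun _ hx => hx.trans h,
    eLpNormEssSup_le_of_ae_enorm_bound⟩

/-- If the ME-cocycle `c : L × Y → K` is `L^p`-integrable then the `L^p`-norm of `|c(l, ·)|` is
finite for every `l`, and grows at most linearly in the word norm of `l`. -/
theorem exists_eLpNorm_cocycle_le [(haar : Measure K).IsMulRightInvariant] [IsFiniteMeasure ν]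
    [SFinite m] (i : FundamentalIso K a m Y ν)
    (ha : IsMPAction a m) (hb : IsMPAction b m) (hab : ∀ k l ω, a k (b l ω) = b l (a k ω))
    {c : L × Y → K} (hc : IsMECocycle i b c) {p : ℝ≥0∞} (hp : 1 ≤ p) {S : Set K}
    (hS : IsCompactGenerating S)
    (hSp : ∀ᵐ l ∂(haar : Measure L), MemLp (fun y => (wordNorm S (c (l, y)) : ℝ)) p ν)
    {T : Set L} (hT : IsCompactGenerating T) :
    ∃ M : ℝ≥0∞, M ≠ ∞ ∧ ∀ l, eLpNorm (fun y => (wordNorm S (c (l, y)) : ℝ)) p ν ≤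
      M * wordNorm T l := by
  obtain ⟨E, hE, hE0, hE1⟩ : ∃ E : Set K, MeasurableSet E ∧ (haar : Measure K) E ≠ 0 ∧
      (haar : Measure K) E ≠ ∞ := by
    have C : TopologicalSpace.PositiveCompacts K := Classical.arbitrary _
    exact ⟨C, C.isCompact.isClosed.measurableSet,
      (measure_pos_of_nonempty_interior _ C.interior_nonempty).ne', C.isCompact.measure_lt_top.ne⟩
  have hw : Measurable fun k : K => (wordNorm S k : ℝ) :=
    measurable_from_top.comp (measurable_wordNorm hS)
  have hwc : Measurable fun z : L × Y => (wordNorm S (c z) : ℝ) := hw.comp hc.1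
  -- the displacement function on `Ω`, which factors through the cocycle
  let N : L → Ω → ℝ := fun l ω => wordNorm S ((i.coord (b l ω))⁻¹ * i.coord ω)
  have hN : ∀ l, Measurable (N l) := fun l =>
    hw.comp ((i.measurable_coord.comp (hb.map l).measurable).inv.mul i.measurable_coord)
  have eN : ∀ l k, ∀ᵐ ω ∂m, N l (a k ω) = N l ω := fun l k => by
    filter_upwards [i.coord_act k, (hb.map l).quasiMeasurePreserving.ae (i.coord_act k)]
      with ω h1 h2
    simp only [N]
    rw [← hab, h1, h2]
    simp [mul_assoc]
  -- `m` on `{coord ∈ E}` maps to `ν'`, so `q l` is also the norm of `N l` on that set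
  let ν' : Measure Y := (haar : Measure K) E • ν
  have : IsFiniteMeasure ν' := ⟨by
    simpa [ν'] using ENNReal.mul_lt_top hE1.lt_top (measure_lt_top ν Set.univ)⟩
  let q : L → ℝ≥0∞ := fun l => eLpNorm (fun y => (wordNorm S (c (l, y)) : ℝ)) p ν'
  let m' : Measure Ω := m.restrict (i.coord ⁻¹' E)
  have hqN : ∀ l, q l = eLpNorm (N l) p m' := fun l => by
    simp only [q, ν', ← i.map_base hE]
    have hl : Measurable fun y => (wordNorm S (c (l, y)) : ℝ) :=
      hwc.comp (measurable_const.prodMk measurable_id)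
    rw [eLpNorm_map_measure hl.aestronglyMeasurable i.measurable_base.aemeasurable]
    refine eLpNorm_congr_ae (ae_restrict_of_ae ?_)
    filter_upwards [hc.ae_eq l] with ω h
    simp only [Function.comp, h, N]
  have hinv : ∀ l l', eLpNorm (fun ω => N l (b l' ω)) p m' = q l := fun l l' => by
    rw [hqN]
    exact eLpNorm_comp_act ha hb hab i.measurable_coord i.coord_act hE hE0 hE1 p (hN l) (eN l) l'
  have q_one : q 1 = 0 := by
    have : N 1 = 0 := by ext ω; simp [N, hb.one, wordNorm_one]
    rw [hqN, this, eLpNorm_zero]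
  have q_mul : ∀ g h, q (g * h) ≤ q g + q h := fun g h => by
    rw [← hinv g h, hqN h, hqN (g * h)]
    refine le_trans (eLpNorm_mono_real fun ω => ?_) (eLpNorm_add_le
      ((hN g).comp (hb.map h).measurable).aestronglyMeasurable (hN h).aestronglyMeasurable hp)
    have e : (i.coord (b (g * h) ω))⁻¹ * i.coord ω = ((i.coord (b g (b h ω)))⁻¹ *
        i.coord (b h ω)) * ((i.coord (b h ω))⁻¹ * i.coord ω) := by rw [hb.mul]; group
    simp only [N, Pi.add_apply, Real.norm_natCast]
    rw [e]
    exact_mod_cast wordNorm_mul_le hS _ _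
  have q_inv : ∀ g, q g⁻¹ = q g := fun g => by
    rw [← hinv g⁻¹ g, hqN g]
    congr 1
    ext ω
    simp only [N, hb.inv_self]
    rw [← wordNorm_inv hS]
    simp
  have hq : Measurable q := by
    rcases eq_or_ne p ∞ with rfl | hpt
    · refine measurable_of_Iic fun r => ?_
      have : q ⁻¹' Set.Iic r = {l | ν' {y | r < ‖(wordNorm S (c (l, y)) : ℝ)‖ₑ} = 0} := by
        ext l
        simp only [Set.mem_preimage, Set.mem_Iic, q, eLpNorm_exponent_top, eLpNormEssSup_le_iff_ae]
        rw [ae_iff]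
        simp only [not_le]
        rfl
      rw [this]
      have hm : MeasurableSet {z : L × Y | r < ‖(wordNorm S (c z) : ℝ)‖ₑ} :=
        measurableSet_lt measurable_const hwc.enorm
      exact (measurable_measure_prodMk_left hm) (measurableSet_singleton 0)
    · have hp0 : p ≠ 0 := (zero_lt_one.trans_le hp).ne'
      simp only [q, eLpNorm_eq_lintegral_rpow_enorm_toReal hp0 hpt]
      have hm : Measurable fun z : L × Y => ‖(wordNorm S (c z) : ℝ)‖ₑ ^ p.toReal :=
        hwc.enorm.pow_const _
      exact hm.lintegral_prod_right'.pow_const _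
  have hfin : ∀ᵐ l ∂(haar : Measure L), q l < ∞ := by
    filter_upwards [hSp] with l hl
    exact (hl.smul_measure hE1).2
  obtain ⟨M, hM, hMT⟩ := exists_bound_of_subadditive hq q_mul q_inv hfin hT.1
  refine ⟨((haar : Measure K) E ^ (1 / p).toReal)⁻¹ * M, ?_, fun l => ?_⟩
  · refine ENNReal.mul_ne_top (ENNReal.inv_ne_top.2 ?_) hM
    exact (ENNReal.rpow_pos hE0.bot_lt hE1).ne'
  · have h1 := le_mul_wordNorm hT q_one q_mul hMT l
    simp only [q, ν', eLpNorm_smul_measure_of_ne_zero hE0, smul_eq_mul] at h1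
    have h0 : (haar : Measure K) E ^ (1 / p).toReal ≠ 0 :=
      (ENNReal.rpow_pos hE0.bot_lt hE1).ne'
    have ht : (haar : Measure K) E ^ (1 / p).toReal ≠ ∞ :=
      ENNReal.rpow_ne_top_of_nonneg ENNReal.toReal_nonneg hE1
    rw [mul_assoc]
    calc _ = ((haar : Measure K) E ^ (1 / p).toReal)⁻¹ * ((haar : Measure K) E ^ (1 / p).toReal *
          eLpNorm (fun y => (wordNorm S (c (l, y)) : ℝ)) p ν) := by
          rw [← mul_assoc, ENNReal.inv_mul_cancel h0 ht, one_mul]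
      _ ≤ _ := by gcongr

/-- The composition of ME-cocycles is `L^p`-integrable: if the `L^p`-norms of `f` over the first
coordinate are controlled by a function in `L^p` of the second one, then `f` is in `L^p`. -/
theorem memLp_prod_of_eLpNorm_le {X Y : Type u} [MeasurableSpace X] [MeasurableSpace Y]
    {μ : Measure X} {ν : Measure Y} [SFinite μ] [SFinite ν] {p : ℝ≥0∞} (hp : p ≠ 0)
    {f : X × Y → ℝ} (hf : Measurable f) {n : Y → ℝ} (hn : MemLp n p ν) {M : ℝ≥0∞} (hM : M ≠ ∞)
    (h : ∀ y, eLpNorm (fun x => f (x, y)) p μ ≤ M * ‖n y‖ₑ) : MemLp f p (μ.prod ν) := by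
  refine ⟨hf.aestronglyMeasurable, ?_⟩
  rcases eq_or_ne p ∞ with rfl | hpt
  · refine lt_of_le_of_lt (b := M * eLpNorm n ∞ ν) ?_ (ENNReal.mul_lt_top hM.lt_top hn.2)
    rw [eLpNorm_exponent_top, eLpNormEssSup_le_iff_ae]
    have hs : MeasurableSet {z : X × Y | ‖f z‖ₑ ≤ M * eLpNorm n ∞ ν} :=
      measurableSet_le hf.enorm measurable_const
    have h1 : ∀ᵐ y ∂ν, ∀ᵐ x ∂μ, ‖f (x, y)‖ₑ ≤ M * eLpNorm n ∞ ν := by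
      filter_upwards [enorm_ae_le_eLpNormEssSup n ν] with y hy
      filter_upwards [enorm_ae_le_eLpNormEssSup (fun x => f (x, y)) μ] with x hx
      refine hx.trans ?_
      rw [← eLpNorm_exponent_top]
      refine (h y).trans ?_
      gcongr
      rwa [eLpNorm_exponent_top]
    have h2 := (Measure.ae_prod_iff_ae_ae (μ := ν) (ν := μ) (measurable_swap hs)).2 h1
    exact Measure.measurePreserving_swap.quasiMeasurePreserving.ae h2
  · have hp' : 0 < p.toReal := ENNReal.toReal_pos hp hpt
    rw [eLpNorm_lt_top_iff_lintegral_rpow_enorm_lt_top hp hpt]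
    rw [lintegral_prod_symm _ (hf.enorm.pow_const _).aemeasurable]
    have h2 := (eLpNorm_lt_top_iff_lintegral_rpow_enorm_lt_top hp hpt).1 hn.2
    calc _ ≤ ∫⁻ y, M ^ p.toReal * ‖n y‖ₑ ^ p.toReal ∂ν := by
          refine lintegral_mono fun y => ?_
          have h3 := ENNReal.rpow_le_rpow (h y) hp'.le
          rw [ENNReal.mul_rpow_of_nonneg _ _ hp'.le] at h3
          refine le_trans (le_of_eq ?_) h3
          rw [eLpNorm_eq_lintegral_rpow_enorm_toReal hp hpt, ← ENNReal.rpow_mul,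
            one_div, inv_mul_cancel₀ hp'.ne', ENNReal.rpow_one]
      _ < ∞ := by
          rw [lintegral_const_mul' _ _ (ENNReal.rpow_ne_top_of_nonneg hp'.le hM)]
          exact ENNReal.mul_lt_top (ENNReal.rpow_ne_top_of_nonneg hp'.le hM).lt_top h2

end Iso

/-! ### Tautening maps and the strong ICC property -/

theorem MeasEquiv.IsStronglyICCRel.mono {P : Type v} [Group P] [MeasurableSpace P]
    {P₀ P₁ : Subgroup P} (h : IsStronglyICCRel P₀) (hle : P₀ ≤ P₁) : IsStronglyICCRel P₁ :=
  fun ⟨μ, h1, h2, h3⟩ => h ⟨μ, h1, h2, fun g hg => h3 g (hle hg)⟩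

/-- A finite conjugation invariant measure on a strongly ICC group is concentrated at `1`. -/
theorem MeasEquiv.IsStronglyICCRel.measure_compl_one {P : Type v} [Group P] [MeasurableSpace P]
    [MeasurableSingletonClass P] [MeasurableMul₂ P] {P₀ : Subgroup P} (h : IsStronglyICCRel P₀)
    (μ : Measure P) [IsFiniteMeasure μ] (hμ : ∀ g ∈ P₀, μ.map (fun x => g * x * g⁻¹) = μ) :
    μ {1}ᶜ = 0 := by
  by_contra h0
  refine h ⟨(μ {1}ᶜ)⁻¹ • μ.restrict {1}ᶜ, ⟨?_⟩, ?_, fun g hg => ?_⟩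
  · simp [ENNReal.inv_mul_cancel h0 (measure_ne_top μ _)]
  · simp
  · have hm : Measurable fun x : P => g * x * g⁻¹ := by fun_prop
    have hpre : (fun x : P => g * x * g⁻¹) ⁻¹' {1}ᶜ = {1}ᶜ := by ext; simp [mul_inv_eq_one]
    have h2 := Measure.restrict_map (μ := μ) hm (measurableSet_singleton (1 : P)).compl
    rw [hpre, hμ g hg] at h2
    rw [Measure.map_smul, ← h2]

section ProductActions

variable {G H : Type u} [Group G] [MeasurableSpace G] [Group H] [MeasurableSpace H]
  {Ω : Type u} [MeasurableSpace Ω] [MulAction (G × H) Ω] [MeasurableSMul₂ (G × H) Ω]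
  {m : Measure Ω} [SMulInvariantMeasure (G × H) Ω m]

theorem isMPAction_leftAct : IsMPAction (leftAct G H (Ω := Ω)) m where
  measurable := (measurable_fst.prodMk measurable_const).smul measurable_snd
  one ω := one_smul (G × H) ω
  mul k l ω := by simp [leftAct, smul_smul]
  map k := measurePreserving_smul (k, (1 : H)) m

theorem isMPAction_rightAct : IsMPAction (rightAct G H (Ω := Ω)) m where
  measurable := (measurable_const.prodMk measurable_fst).smul measurable_snd
  one ω := one_smul (G × H) ω
  mul k l ω := by simp [rightAct, smul_smul]
  map k := measurePreserving_smul ((1 : G), k) m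

theorem leftAct_rightAct_comm (k : G) (l : H) (ω : Ω) :
    leftAct G H k (rightAct G H l ω) = rightAct G H l (leftAct G H k ω) := by
  simp [leftAct, rightAct, smul_smul]

end ProductActions

section Tautening

variable {G : Type u} [Group G] [TopologicalSpace G] [IsTopologicalGroup G]
  [LocallyCompactSpace G] [SecondCountableTopology G] [T2Space G]
  [MeasurableSpace G] [BorelSpace G] [(haar : Measure G).IsMulRightInvariant]
  {P : Type v} [Group P] [MeasurableSpace P] [StandardBorelSpace P] [MeasurableMul₂ P]
  [MeasurableInv P] {π : G →* P}
  {Ω : Type u} [MeasurableSpace Ω] [MulAction (G × G) Ω] [MeasurableSMul₂ (G × G) Ω]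
  {m : Measure Ω} [SFinite m]

/-- If `P` is strongly ICC relative to `π(G)`, then equivariant maps `F₁, F₂ : Ω → P` agree: the
distribution of `F₁ F₂⁻¹` on the finite measure space `Ω / (1 × G)` is invariant under
conjugation by `π(G)`. -/
theorem ae_eq_of_equivariant [SMulInvariantMeasure (G × G) Ω m]
    (hicc : IsStronglyICCRel π.range) {θ : Ω → G} (hθ : Measurable θ)
    (eθ : ∀ k : G, ∀ᵐ ω ∂m, θ (((1 : G), k) • ω) = k * θ ω)
    (hfin : ∀ E : Set G, MeasurableSet E → (haar : Measure G) E < ∞ → m (θ ⁻¹' E) < ∞)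
    {F₁ F₂ : Ω → P} (hF₁ : Measurable F₁) (hF₂ : Measurable F₂)
    (e₁ : ∀ g₁ g₂ : G, ∀ᵐ ω ∂m, F₁ ((g₁, g₂) • ω) = π g₁ * F₁ ω * (π g₂)⁻¹)
    (e₂ : ∀ g₁ g₂ : G, ∀ᵐ ω ∂m, F₂ ((g₁, g₂) • ω) = π g₁ * F₂ ω * (π g₂)⁻¹) :
    F₁ =ᵐ[m] F₂ := by
  obtain ⟨E, hE, hE0, hE1⟩ : ∃ E : Set G, MeasurableSet E ∧ (haar : Measure G) E ≠ 0 ∧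
      (haar : Measure G) E ≠ ∞ := by
    have C : TopologicalSpace.PositiveCompacts G := Classical.arbitrary _
    exact ⟨C, C.isCompact.isClosed.measurableSet,
      (measure_pos_of_nonempty_interior _ C.interior_nonempty).ne', C.isCompact.measure_lt_top.ne⟩
  let Ψ : Ω → P := fun ω => F₁ ω * (F₂ ω)⁻¹
  have hΨ : Measurable Ψ := hF₁.mul hF₂.inv
  have eΨ : ∀ g₁ g₂ : G, ∀ᵐ ω ∂m, Ψ ((g₁, g₂) • ω) = π g₁ * Ψ ω * (π g₁)⁻¹ := fun g₁ g₂ => by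
    filter_upwards [e₁ g₁ g₂, e₂ g₁ g₂] with ω h1 h2
    simp only [Ψ, h1, h2]
    group
  have eΨr : ∀ k : G, ∀ᵐ ω ∂m, Ψ (rightAct G G k ω) = Ψ ω := fun k => by
    filter_upwards [eΨ 1 k] with ω h
    simpa [rightAct] using h
  have hEfin : IsFiniteMeasure (m.restrict (θ ⁻¹' E)) :=
    ⟨by simpa using hfin E hE hE1.lt_top⟩
  -- the distribution of `Ψ` on `{θ ∈ E}` stands for that on the quotient by `1 × G`
  have hone : (m.restrict (θ ⁻¹' E)).map Ψ {1}ᶜ = 0 := by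
    refine hicc.measure_compl_one _ fun x hx => ?_
    obtain ⟨g, rfl⟩ := hx
    have h1 := map_restrict_comp_act (m := m) (isMPAction_rightAct (G := G) (H := G))
      (isMPAction_leftAct (G := G) (H := G))
      (fun k l ω => (leftAct_rightAct_comm l k ω).symm) hθ eθ hE hE0 hE1 hΨ eΨr g
    rw [Measure.map_map (by fun_prop) hΨ]
    refine Eq.trans (Measure.map_congr (ae_restrict_of_ae ?_)) h1
    filter_upwards [eΨ g 1] with ω h
    exact h.symm
  have hm1 : MeasurableSet ({1}ᶜ : Set P) := (measurableSet_singleton 1).compl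
  have key := mass_transport (m := m) (isMPAction_rightAct (G := G) (H := G)) hθ hθ eθ eθ
    (F := (Ψ ⁻¹' {1}ᶜ).indicator 1) (measurable_one.indicator (hΨ hm1)) (fun k => by
      filter_upwards [eΨr k] with ω h
      change ({1}ᶜ : Set P).indicator (1 : P → ℝ≥0∞) (Ψ _) = ({1}ᶜ : Set P).indicator 1 (Ψ ω)
      rw [h]) hE MeasurableSet.univ
  rw [lintegral_indicator_one (hΨ hm1), lintegral_indicator_one (hΨ hm1),
    ← Measure.map_apply hΨ hm1, hone, mul_zero, Set.preimage_univ, Measure.restrict_univ] at key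
  have h0 : m (Ψ ⁻¹' {1}ᶜ) = 0 := by simpa [hE0] using key.symm
  filter_upwards [measure_eq_zero_iff_ae_notMem.1 h0] with ω h
  simpa [Ψ, mul_inv_eq_one] using h

/-- A measurable map that is almost everywhere equivariant under each single `(g₁, g₂)` can be
changed on a null set so that the exceptional null set no longer depends on `(g₁, g₂)`: the new
value at `ω` is the almost sure value of `π(g₁)⁻¹ Φ((g₁, g₂) ω) π(g₂)`, wherever there is one. -/
theorem exists_isTautening (hπ : Measurable π) {Φ₀ : Ω → P} (hΦ₀ : Measurable Φ₀)
    (e₀ : ∀ g₁ g₂ : G, ∀ᵐ ω ∂m, Φ₀ ((g₁, g₂) • ω) = π g₁ * Φ₀ ω * (π g₂)⁻¹) :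
    ∃ Φ : Ω → P, IsTautening π m Φ := by
  classical
  let κ : Measure (G × G) := (haar : Measure G).prod haar
  have hκ0 : NeZero κ := ⟨by
    intro h
    have := congrArg (fun μ => μ Set.univ) h
    simp only [κ, ← Set.univ_prod_univ, Measure.prod_prod] at this
    simp [NeZero.ne (haar : Measure G)] at this⟩
  -- a probability measure equivalent to the Haar measure of `G × G`
  let lam : Measure (G × G) := κ.toFinite
  have hlam : ∀ {p : G × G → Prop}, (∀ᵐ h ∂lam, p h) ↔ ∀ᵐ h ∂κ, p h := by
    intro p
    rw [ae_toFinite]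
  let f : Ω × (G × G) → P := fun z => (π z.2.1)⁻¹ * Φ₀ (z.2 • z.1) * π z.2.2
  have hf : Measurable f := by
    have h1 : Measurable fun z : Ω × (G × G) => z.2 • z.1 := measurable_snd.smul measurable_fst
    exact ((hπ.comp (measurable_fst.comp measurable_snd)).inv.mul (hΦ₀.comp h1)).mul
      (hπ.comp (measurable_snd.comp measurable_snd))
  have hfg : ∀ (g h : G × G) (ω : Ω), f (g • ω, h) = π g.1 * f (ω, h * g) * (π g.2)⁻¹ := by
    intro g h ω
    simp only [f, smul_smul, Prod.fst_mul, Prod.snd_mul, map_mul]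
    group
  have hae : ∀ᵐ ω ∂m, ∀ᵐ h ∂lam, f (ω, h) = Φ₀ ω := by
    have hs : MeasurableSet {z : Ω × (G × G) | f z = Φ₀ z.1} :=
      measurableSet_eq_fun hf (hΦ₀.comp measurable_fst)
    refine (Measure.ae_ae_comm (p := fun ω h => f (ω, h) = Φ₀ ω) hs).2 (.of_forall fun h => ?_)
    filter_upwards [e₀ h.1 h.2] with ω hω
    simp only [f]
    rw [show h • ω = (h.1, h.2) • ω from rfl, hω]
    group
  -- through a Borel embedding in `ℝ`, the almost sure value of `f (ω, ·)` becomes its average,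
  -- which is measurable in `ω`
  let emb : P → ℝ := embeddingReal P
  have hemb : MeasurableEmbedding emb := measurableEmbedding_embeddingReal P
  let avg : Ω → ℝ := fun ω => ∫ h, emb (f (ω, h)) ∂lam
  have havg : Measurable avg :=
    ((hemb.measurable.comp hf).stronglyMeasurable.integral_prod_right' (ν := lam)).measurable
  have hconst : ∀ ω x, (∀ᵐ h ∂lam, f (ω, h) = x) → avg ω = emb x := fun ω x hx => by
    have : avg ω = ∫ _, emb x ∂lam := integral_congr_ae (hx.mono fun h hh => by simp [hh])
    rw [this]
    simp
  let Ω₀ : Set Ω := {ω | lam {h | emb (f (ω, h)) ≠ avg ω} = 0}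
  have hΩ₀ : MeasurableSet Ω₀ := by
    have hs : MeasurableSet {z : Ω × (G × G) | emb (f z) ≠ avg z.1} :=
      (measurableSet_eq_fun (hemb.measurable.comp hf) (havg.comp measurable_fst)).compl
    exact (measurable_measure_prodMk_left hs) (measurableSet_singleton 0)
  have hmem : ∀ ω, ω ∈ Ω₀ ↔ ∃ x, ∀ᵐ h ∂lam, f (ω, h) = x := fun ω => by
    constructor
    · intro hω
      have hω' : ∀ᵐ h ∂lam, emb (f (ω, h)) = avg ω := by
        rw [ae_iff]; exact hω
      obtain ⟨h₀, hh₀⟩ := hω'.exists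
      refine ⟨f (ω, h₀), hω'.mono fun h hh => hemb.injective (hh.trans hh₀.symm)⟩
    · rintro ⟨x, hx⟩
      change lam {h | ¬ (emb (f (ω, h)) = avg ω)} = 0
      rw [← ae_iff, hconst ω x hx]
      exact hx.mono fun h hh => by rw [hh]
  have : Nonempty P := ⟨1⟩
  let Φ : Ω → P := fun ω => if ω ∈ Ω₀ then hemb.invFun (avg ω) else 1
  have hΦ : Measurable Φ := Measurable.ite hΩ₀ (hemb.measurable_invFun.comp havg) measurable_const
  have hΦx : ∀ ω x, (∀ᵐ h ∂lam, f (ω, h) = x) → Φ ω = x := fun ω x hx => by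
    simp only [Φ, if_pos ((hmem ω).2 ⟨x, hx⟩), hconst ω x hx]
    exact hemb.leftInverse_invFun x
  refine ⟨Φ, hΦ, ?_⟩
  filter_upwards [hae] with ω hω g₁ g₂
  rw [hΦx ω _ hω]
  apply hΦx
  have h1 := (measurePreserving_mul_right κ (g₁, g₂)).quasiMeasurePreserving.ae (hlam.1 hω)
  refine hlam.2 (h1.mono fun h hh => ?_)
  rw [hfg, hh]

end Tautening

/-! ### Tautness forces the strong ICC property -/

section ICC

variable {H : Type u} [Group H] [TopologicalSpace H] [IsTopologicalGroup H]
  [LocallyCompactSpace H] [SecondCountableTopology H] [T2Space H]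
  [MeasurableSpace H] [BorelSpace H]
  {P : Type u} [Group P] [MeasurableSpace P]

/-- The action `(g₁, g₂) : (g, x) ↦ (g₁ g g₂⁻¹, π(g₁) x π(g₁)⁻¹)` of `H × H` on `H × P`. -/
@[reducible]
def conjAction (π : H →* P) : MulAction (H × H) (H × P) where
  smul a z := (a.1 * z.1 * a.2⁻¹, π a.1 * z.2 * (π a.1)⁻¹)
  one_smul z := by
    change ((1 : H) * z.1 * (1 : H)⁻¹, π 1 * z.2 * (π 1)⁻¹) = z
    simp
  mul_smul a b z := by
    change ((a.1 * b.1) * z.1 * (a.2 * b.2)⁻¹, π (a.1 * b.1) * z.2 * (π (a.1 * b.1))⁻¹) =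
      (a.1 * (b.1 * z.1 * b.2⁻¹) * a.2⁻¹, π a.1 * (π b.1 * z.2 * (π b.1)⁻¹) * (π a.1)⁻¹)
    simp [mul_assoc]

/-- Both factors of `H × H` have `P` as quotient. For the first factor one untwists the conjugation
by `(g, x) ↦ (g, π(g) x π(g)⁻¹)`. -/
theorem isCoupling_conjAction [(haar : Measure H).IsMulRightInvariant] [StandardBorelSpace P]
    [MeasurableMul₂ P] [MeasurableInv P] {π : H →* P} (hπ : Measurable π)
    (μ : Measure P) [IsProbabilityMeasure μ]
    (hμ : ∀ g ∈ π.range, μ.map (fun x => g * x * g⁻¹) = μ) :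
    letI := conjAction π
    IsCoupling H H ((haar : Measure H).prod μ) := by
  let _ := conjAction π
  have := standardBorelSpace_of_lcsc H
  have := haar_isInvInvariant H
  have hsmul : ∀ (a : H × H) (z : H × P),
    a • z = (a.1 * z.1 * a.2⁻¹, π a.1 * z.2 * (π a.1)⁻¹) := fun _ _ => rfl
  have hconj : ∀ g : H, MeasurePreserving (fun x : P => π g * x * (π g)⁻¹) μ μ := fun g =>
    ⟨by fun_prop, hμ _ ⟨g, rfl⟩⟩
  have hmeas : Measurable fun z : H × P => (z.1, π z.1 * z.2 * (π z.1)⁻¹) := by fun_prop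
  refine ⟨inferInstance, inferInstance, ?_, ⟨?_⟩, ⟨fun a s hs => ?_⟩,
    ⟨P, inferInstance, inferInstance, μ, inferInstance, ⟨?_⟩⟩,
    ⟨P, inferInstance, inferInstance, μ, inferInstance, ⟨?_⟩⟩⟩
  · intro h
    have := congrArg (fun μ => μ Set.univ) h
    simp only [← Set.univ_prod_univ, Measure.prod_prod] at this
    simp [NeZero.ne (haar : Measure H)] at this
  · change Measurable fun z : (H × H) × (H × P) =>
      (z.1.1 * z.2.1 * z.1.2⁻¹, π z.1.1 * z.2.2 * (π z.1.1)⁻¹)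
    fun_prop
  · have h1 : MeasurePreserving (fun x : H => a.1 * x * a.2⁻¹) haar haar :=
      (measurePreserving_mul_right haar a.2⁻¹).comp (measurePreserving_mul_left haar a.1)
    exact (h1.prod (hconj a.1)).measure_preimage hs.nullMeasurableSet
  · exact
      { toFun := fun z => (z.1, π z.1 * z.2 * (π z.1)⁻¹)
        invFun := fun z => (z.1, (π z.1)⁻¹ * z.2 * π z.1)
        measurePreserving_toFun := (MeasurePreserving.id haar).skew_product
          (g := fun h x => π h * x * (π h)⁻¹) (by fun_prop) (.of_forall fun h => (hconj h).map_eq)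
        measurable_invFun := by fun_prop
        left_inv := .of_forall fun z => by simp [mul_assoc]
        right_inv := .of_forall fun z => by simp [mul_assoc]
        equivariant := .of_forall fun z k => by
          simp [leftAct, hsmul, mul_assoc] }
  · exact
      { toFun := fun z => (z.1⁻¹, z.2)
        invFun := fun z => (z.1⁻¹, z.2)
        measurePreserving_toFun := (measurePreserving_inv haar).prod (MeasurePreserving.id μ)
        measurable_invFun := by fun_prop
        left_inv := .of_forall fun z => by simp
        right_inv := .of_forall fun z => by simp
        equivariant := .of_forall fun z k => by
          simp [rightAct, hsmul] }

/-- If `P` carries a probability measure `μ` invariant under conjugation by `π(H)`, then on the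
coupling `H × (P, μ)` both `(g, x) ↦ π(g)` and `(g, x) ↦ x π(g)` are tautening maps.
By uniqueness `μ` is concentrated at `1`. -/
theorem MeasEquiv.IsTautRel.isStronglyICCRel [(haar : Measure H).IsMulRightInvariant]
    [StandardBorelSpace P] [MeasurableMul₂ P] [MeasurableInv P] {π : H →* P} (hπ : Measurable π)
    (h : IsTautRel π) : IsStronglyICCRel π.range := by
  rintro ⟨μ, hμ, hμ1, hinv⟩
  let _ := conjAction π
  have hsmul : ∀ (a : H × H) (z : H × P),
    a • z = (a.1 * z.1 * a.2⁻¹, π a.1 * z.2 * (π a.1)⁻¹) := fun _ _ => rfl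
  obtain ⟨Φ, -, hu⟩ := h (H × P) ((haar : Measure H).prod μ) (isCoupling_conjAction hπ μ hinv)
  have h1 := hu (fun z => π z.1) ⟨hπ.comp measurable_fst, .of_forall fun z g₁ g₂ => by
    simp [hsmul]⟩
  have h2 := hu (fun z => z.2 * π z.1) ⟨measurable_snd.mul (hπ.comp measurable_fst),
    .of_forall fun z g₁ g₂ => by simp [hsmul, mul_assoc]⟩
  have h3 : ∀ᵐ z ∂(haar : Measure H).prod μ, z.2 = 1 := by
    filter_upwards [h1, h2] with z h1 h2
    have := h2.trans h1.symm
    simpa using this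
  obtain ⟨g, hg⟩ := (Measure.ae_ae_of_ae_prod h3).exists
  have h4 : ∀ᵐ x ∂μ, False := by
    filter_upwards [hg, measure_eq_zero_iff_ae_notMem.1 hμ1] with x hx hx1
    exact hx1 hx
  simp only [Filter.eventually_false_iff_eq_bot, ae_eq_bot] at h4
  exact NeZero.ne μ h4

end ICC

/-! ### Inducing couplings from a lattice -/

theorem measurePreserving_prod_interchange {A B C D : Type*} [MeasurableSpace A] [MeasurableSpace B]
    [MeasurableSpace C] [MeasurableSpace D] (α : Measure A) (β : Measure B) (γ : Measure C)
    (δ : Measure D) [SFinite α] [SFinite β] [SFinite γ] [SFinite δ] :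
    MeasurePreserving (fun z : (A × B) × (C × D) => (z.1.1, (z.2.1, (z.1.2, z.2.2))))
      ((α.prod β).prod (γ.prod δ)) (α.prod (γ.prod (β.prod δ))) := by
  have h1 : MeasurePreserving (fun z : B × (C × D) => (z.2.1, (z.1, z.2.2)))
      (β.prod (γ.prod δ)) (γ.prod (β.prod δ)) :=
    (measurePreserving_prodAssoc γ β δ).comp
      ((Measure.measurePreserving_swap.prod (MeasurePreserving.id δ)).comp
        (MeasurePreserving.symm _ (measurePreserving_prodAssoc β γ δ)))
  exact ((MeasurePreserving.id α).prod h1).comp (measurePreserving_prodAssoc α β (γ.prod δ))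

theorem ae_prod_snd_snd {A B C : Type*} [MeasurableSpace A] [MeasurableSpace B]
    [MeasurableSpace C] {α : Measure A} {β : Measure B} {γ : Measure C}
    [SFinite α] [SFinite β] [SFinite γ] {p : C → Prop} (h : ∀ᵐ z ∂γ, p z) :
    ∀ᵐ z ∂α.prod (β.prod γ), p z.2.2 :=
  Measure.quasiMeasurePreserving_snd.ae (Measure.quasiMeasurePreserving_snd.ae h)

/-- Transport of a fundamental isomorphism along an equivariant isomorphism of measure spaces. -/
def MeasEquiv.FundamentalIso.transport {K : Type u} [Group K] [TopologicalSpace K]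
    [IsTopologicalGroup K] [LocallyCompactSpace K] [MeasurableSpace K] [BorelSpace K]
    {Ω Ω' : Type u} [MeasurableSpace Ω] [MeasurableSpace Ω'] {a : K → Ω → Ω} {a' : K → Ω' → Ω'}
    {m : Measure Ω} {m' : Measure Ω'} {Y : Type u} [MeasurableSpace Y] {ν : Measure Y}
    (i : FundamentalIso K a m Y ν) (e : Ω ≃ᵐ Ω') (he : MeasurePreserving e m m')
    (hea : ∀ k ω, e (a k ω) = a' k (e ω)) : FundamentalIso K a' m' Y ν where
  toFun z := e (i.toFun z)
  invFun ω := i.invFun (e.symm ω)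
  measurePreserving_toFun := he.comp i.measurePreserving_toFun
  measurable_invFun := i.measurable_invFun.comp e.symm.measurable
  left_inv := by simpa using i.left_inv
  right_inv := by
    filter_upwards [(he.symm e).quasiMeasurePreserving.ae i.right_inv] with ω h
    rw [h, e.apply_symm_apply]
  equivariant := by
    filter_upwards [i.equivariant] with z h k
    rw [h k, hea]

section Induced

variable {G : Type u} [Group G] [TopologicalSpace G] [IsTopologicalGroup G]
  [LocallyCompactSpace G] [SecondCountableTopology G] [T2Space G]
  [MeasurableSpace G] [BorelSpace G] [(haar : Measure G).IsMulRightInvariant]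
  {Γ : Subgroup G} [IsLattice Γ] {Θ : G → Γ} (hΘ : IsDomainCoord Γ Θ)
  {Ω : Type u} [MeasurableSpace Ω] {m : Measure Ω} [SFinite m]
  {Y : Type u} [MeasurableSpace Y] {ν : Measure Y} [IsFiniteMeasure ν]

namespace IsDomainCoord

variable (ν) in
theorem measurePreserving_split :
    MeasurePreserving (fun z : G × (hΘ.Dom × Y) => (hΘ.rep z.1, (z.2.1, ((Θ z.1)⁻¹, z.2.2))))
      ((haar : Measure G).prod (hΘ.vol.prod ν))
      (hΘ.vol.prod (hΘ.vol.prod ((haar : Measure Γ).prod ν))) := by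
  have := Γ.countable_of_discrete
  exact (measurePreserving_prod_interchange hΘ.vol (haar : Measure Γ) hΘ.vol ν).comp
    (hΘ.measurePreserving_rep.prod (MeasurePreserving.id (hΘ.vol.prod ν)))

theorem coc_rep (k g : G) : hΘ.coc k (hΘ.rep g) = (Θ (k * g))⁻¹ * Θ g := by
  rw [coc, incl_rep, ← mul_assoc, hΘ.equivariant]
  simp

theorem smul_rep (k g : G) : k • hΘ.rep g = hΘ.rep (k * g) := by
  rw [smul_def, incl_rep, ← mul_assoc, rep_mul]

/-- A `Γ`-equivariant isomorphism `Γ × Y ≅ Ω` induces a `G`-equivariant isomorphism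
`G × (D × Y) ≅ D × D × Ω`, where `G` acts on the product of the first factor `D` and of `Ω` as on
`G ×_Γ Ω`. -/
noncomputable def inducedIso {a : Γ → Ω → Ω} (i : FundamentalIso Γ a m Y ν) :
    FundamentalIso G (fun (g : G) (z : hΘ.Dom × hΘ.Dom × Ω) =>
        (g • z.1, z.2.1, a (hΘ.coc g z.1) z.2.2))
      (hΘ.vol.prod (hΘ.vol.prod m)) (hΘ.Dom × Y) (hΘ.vol.prod ν) where
  toFun z := (hΘ.rep z.1, z.2.1, i.toFun ((Θ z.1)⁻¹, z.2.2))
  invFun z := (hΘ.incl z.1 * (i.invFun z.2.2).1, z.2.1, (i.invFun z.2.2).2)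
  measurePreserving_toFun := ((MeasurePreserving.id hΘ.vol).prod
    ((MeasurePreserving.id hΘ.vol).prod i.measurePreserving_toFun)).comp
      (hΘ.measurePreserving_split ν)
  measurable_invFun := by
    have h1 := i.measurable_invFun
    have h2 := hΘ.measurable_incl
    have h3 : Measurable ((↑) : Γ → G) := measurable_subtype_coe
    fun_prop
  left_inv := by
    have h := ae_prod_snd_snd (α := hΘ.vol) (β := hΘ.vol) i.left_inv
    filter_upwards [(hΘ.measurePreserving_split ν).quasiMeasurePreserving.ae h] with z hz
    rw [hz, incl_rep]
    simp
  right_inv := by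
    have h := ae_prod_snd_snd (α := hΘ.vol) (β := hΘ.vol) i.right_inv
    filter_upwards [h] with z hz
    rw [rep_incl_mul, hΘ.equivariant, hΘ.apply_incl]
    simp [hz]
  equivariant := by
    have h := ae_prod_snd_snd (α := hΘ.vol) (β := hΘ.vol) i.equivariant
    filter_upwards [(hΘ.measurePreserving_split ν).quasiMeasurePreserving.ae h] with z hz k
    rw [smul_rep, ← hz, coc_rep]
    simp

/-- The ME-cocycle of an induced coupling is the composition of the cocycle of the lattice and the
given ME-cocycle. -/
theorem isMECocycle_inducedIso {a b : Γ → Ω → Ω} {i : FundamentalIso Γ a m Y ν}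
    {c : Γ × Y → Γ} (hc : IsMECocycle i b c) :
    IsMECocycle (hΘ.inducedIso i)
      (fun (g : G) (z : hΘ.Dom × hΘ.Dom × Ω) => (z.1, g • z.2.1, b (hΘ.coc g z.2.1) z.2.2))
      (fun z => (c (hΘ.coc z.1 z.2.1, z.2.2) : G)) := by
  have := Γ.countable_of_discrete
  refine ⟨?_, fun g => ?_⟩
  · have h1 := hΘ.measurable_coc
    exact measurable_subtype_coe.comp (hc.1.comp ((h1.comp (measurable_fst.prodMk
      (measurable_fst.comp measurable_snd))).prodMk (measurable_snd.comp measurable_snd)))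
  · have h := ae_prod_snd_snd (α := hΘ.vol) (β := hΘ.vol) (ae_all_iff.2 hc.2)
    filter_upwards [(hΘ.measurePreserving_split ν).quasiMeasurePreserving.ae h] with z hz
    simp only [inducedIso]
    rw [hz, incl_rep]
    simp

/-- The inclusion of the lattice is Lipschitz for the word norms. -/
theorem exists_wordNorm_le {S : Set Γ} (hS : IsCompactGenerating S) {T : Set G}
    (hT : IsCompactGenerating T) :
    ∃ C : ℝ≥0∞, C ≠ ∞ ∧ ∀ γ : Γ, (wordNorm T (γ : G) : ℝ≥0∞) ≤ C * wordNorm S γ := by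
  have hfin : S.Finite := hS.1.finite_of_discrete
  refine ⟨∑ s ∈ hfin.toFinset, (wordNorm T (s : G) : ℝ≥0∞), ?_, fun γ => ?_⟩
  · exact (ENNReal.sum_lt_top.2 fun s _ => by simp).ne
  · refine le_mul_wordNorm hS (q := fun γ : Γ => (wordNorm T (γ : G) : ℝ≥0∞))
      (by simp [wordNorm_one]) (fun g h => ?_) (fun s hs => ?_) γ
    · exact_mod_cast wordNorm_mul_le hT _ _
    · exact Finset.single_le_sum (f := fun s : Γ => (wordNorm T (s : G) : ℝ≥0∞)) (by simp)
        (hfin.mem_toFinset.2 hs)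

theorem isLpCocycle_induced {a b : Γ → Ω → Ω} {i : FundamentalIso Γ a m Y ν}
    {c : Γ × Y → Γ} (hc : IsMECocycle i b c) (ha : IsMPAction a m) (hb : IsMPAction b m)
    (hab : ∀ k l ω, a k (b l ω) = b l (a k ω)) {p : ℝ≥0∞} (hp : 1 ≤ p)
    (hcp : IsLpCocycle p ν c) {S : Set Γ} (hS : IsCompactGenerating S) {T : Set G}
    (hT : IsCompactGenerating T)
    (hΘp : ∀ g : G, MemLp (fun d => (wordNorm S (hΘ.coc g d) : ℝ)) p hΘ.vol) :
    IsLpCocycle p (hΘ.vol.prod ν)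
      (fun z : G × (hΘ.Dom × Y) => (c (hΘ.coc z.1 z.2.1, z.2.2) : G)) := by
  have := Γ.countable_of_discrete
  have := haar_isMulRightInvariant_of_discrete Γ
  obtain ⟨S', hS', hint⟩ := hcp
  obtain ⟨M, hM, hle⟩ := exists_eLpNorm_cocycle_le i ha hb hab hc hp hS' hint hS
  obtain ⟨C, hC, hCle⟩ := exists_wordNorm_le hS' hT
  refine ⟨T, hT, .of_forall fun g => ?_⟩
  have hm : Measurable fun z : Y × hΘ.Dom =>
      (wordNorm T (c (hΘ.coc g z.2, z.1) : G) : ℝ) := by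
    have h1 : Measurable (hΘ.coc g) :=
      hΘ.measurable_coc.comp (measurable_const.prodMk measurable_id)
    have h2 : Measurable fun z : Y × hΘ.Dom => c (hΘ.coc g z.2, z.1) :=
      hc.1.comp ((h1.comp measurable_snd).prodMk measurable_fst)
    have h3 : Measurable fun γ : Γ => (wordNorm T (γ : G) : ℝ) := measurable_of_countable _
    exact h3.comp h2
  have hbound : ∀ γ : Γ, eLpNorm (fun y => (wordNorm T (c (γ, y) : G) : ℝ)) p ν ≤
      C * M * ‖(wordNorm S γ : ℝ)‖ₑ := fun γ => by
    have h1 : eLpNorm (fun y => (wordNorm T (c (γ, y) : G) : ℝ)) p ν ≤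
        C * eLpNorm (fun y => (wordNorm S' (c (γ, y)) : ℝ)) p ν := by
      lift C to NNReal using hC
      refine eLpNorm_le_nnreal_smul_eLpNorm_of_ae_le_mul' (.of_forall fun y => ?_) p
      simpa using hCle (c (γ, y))
    refine h1.trans ?_
    rw [mul_assoc]
    gcongr
    simpa using hle γ
  have key : MemLp (fun z : Y × hΘ.Dom => (wordNorm T (c (hΘ.coc g z.2, z.1) : G) : ℝ)) p
      (ν.prod hΘ.vol) :=
    memLp_prod_of_eLpNorm_le (zero_lt_one.trans_le hp).ne' hm (hΘp g) (ENNReal.mul_ne_top hC hM)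
      fun d => hbound (hΘ.coc g d)
  have h := key.comp_measurePreserving (Measure.measurePreserving_swap (μ := hΘ.vol) (ν := ν))
  simp only [Function.comp_def, Prod.fst_swap, Prod.snd_swap] at h
  exact h

variable [MulAction (Γ × Γ) Ω]

/-- The action of `G × G` on `D × D × Ω ≅ G ×_Γ Ω ×_Γ G` induced from an action of `Γ × Γ`. -/
@[reducible]
def inducedAction (Ω : Type u) [MulAction (Γ × Γ) Ω] :
    MulAction (G × G) (hΘ.Dom × hΘ.Dom × Ω) where
  smul g z := (g.1 • z.1, g.2 • z.2.1, (hΘ.coc g.1 z.1, hΘ.coc g.2 z.2.1) • z.2.2)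
  one_smul z := by
    change ((1 : G) • z.1, (1 : G) • z.2.1, (hΘ.coc 1 z.1, hΘ.coc 1 z.2.1) • z.2.2) = z
    rw [coc_one, coc_one, one_smul, one_smul]
    exact Prod.ext rfl (Prod.ext rfl (one_smul (Γ × Γ) _))
  mul_smul g h z := by
    change ((g.1 * h.1) • z.1, (g.2 * h.2) • z.2.1,
      (hΘ.coc (g.1 * h.1) z.1, hΘ.coc (g.2 * h.2) z.2.1) • z.2.2) =
      (g.1 • h.1 • z.1, g.2 • h.2 • z.2.1, (hΘ.coc g.1 (h.1 • z.1), hΘ.coc g.2 (h.2 • z.2.1)) •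
        (hΘ.coc h.1 z.1, hΘ.coc h.2 z.2.1) • z.2.2)
    refine Prod.ext (mul_smul _ _ _) (Prod.ext (mul_smul _ _ _) ?_)
    change (hΘ.coc (g.1 * h.1) z.1, hΘ.coc (g.2 * h.2) z.2.1) • z.2.2 = _
    rw [coc_mul, coc_mul]
    exact mul_smul (hΘ.coc g.1 (h.1 • z.1), hΘ.coc g.2 (h.2 • z.2.1))
      (hΘ.coc h.1 z.1, hΘ.coc h.2 z.2.1) z.2.2

theorem leftAct_induced :
    letI := hΘ.inducedAction Ω
    leftAct G G (Ω := hΘ.Dom × hΘ.Dom × Ω) = fun (g : G) (z : hΘ.Dom × hΘ.Dom × Ω) =>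
      (g • z.1, z.2.1, leftAct Γ Γ (hΘ.coc g z.1) z.2.2) := by
  ext1 g; ext1 z
  change (g • z.1, (1 : G) • z.2.1, (hΘ.coc g z.1, hΘ.coc 1 z.2.1) • z.2.2) = _
  rw [one_smul, coc_one]
  rfl

theorem rightAct_induced :
    letI := hΘ.inducedAction Ω
    rightAct G G (Ω := hΘ.Dom × hΘ.Dom × Ω) = fun (g : G) (z : hΘ.Dom × hΘ.Dom × Ω) =>
      (z.1, g • z.2.1, rightAct Γ Γ (hΘ.coc g z.2.1) z.2.2) := by
  ext1 g; ext1 z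
  change ((1 : G) • z.1, g • z.2.1, (hΘ.coc 1 z.1, hΘ.coc g z.2.1) • z.2.2) = _
  rw [one_smul, coc_one]
  rfl

end IsDomainCoord

end Induced

section InducedCoupling

theorem MeasEquiv.IsMECocycle.transport {K : Type u} [Group K] [TopologicalSpace K]
    [IsTopologicalGroup K] [LocallyCompactSpace K] [MeasurableSpace K] [BorelSpace K]
    {L : Type u} [MeasurableSpace L]
    {Ω Ω' : Type u} [MeasurableSpace Ω] [MeasurableSpace Ω'] {a : K → Ω → Ω} {a' : K → Ω' → Ω'}
    {m : Measure Ω} {m' : Measure Ω'} {Y : Type u} [MeasurableSpace Y] {ν : Measure Y}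
    {i : FundamentalIso K a m Y ν} {b : L → Ω → Ω} {b' : L → Ω' → Ω'} {c : L × Y → K}
    (hc : IsMECocycle i b c) (e : Ω ≃ᵐ Ω') (he : MeasurePreserving e m m')
    (hea : ∀ k ω, e (a k ω) = a' k (e ω)) (heb : ∀ l ω, e (b l ω) = b' l (e ω)) :
    IsMECocycle (i.transport e he hea) b' c := by
  refine ⟨hc.1, fun l => ?_⟩
  filter_upwards [hc.2 l] with z hz
  simp only [FundamentalIso.transport]
  rw [← heb, e.symm_apply_apply, hz]

/-- The equivalence exchanging the first two factors of `A × A × B`. -/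
def swapFirst (A B : Type u) [MeasurableSpace A] [MeasurableSpace B] : A × A × B ≃ᵐ A × A × B where
  toFun z := (z.2.1, z.1, z.2.2)
  invFun z := (z.2.1, z.1, z.2.2)
  left_inv _ := rfl
  right_inv _ := rfl
  measurable_toFun := by change Measurable fun z : A × A × B => (z.2.1, z.1, z.2.2); fun_prop
  measurable_invFun := by change Measurable fun z : A × A × B => (z.2.1, z.1, z.2.2); fun_prop

theorem measurePreserving_swapFirst {A B : Type u} [MeasurableSpace A] [MeasurableSpace B]
    (α : Measure A) (β : Measure B) [SFinite α] [SFinite β] :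
    MeasurePreserving (swapFirst A B) (α.prod (α.prod β)) (α.prod (α.prod β)) :=
  (measurePreserving_prodAssoc α α β).comp
    ((Measure.measurePreserving_swap.prod (MeasurePreserving.id β)).comp
      (MeasurePreserving.symm _ (measurePreserving_prodAssoc α α β)))

variable {G : Type u} [Group G] [TopologicalSpace G] [IsTopologicalGroup G]
  [LocallyCompactSpace G] [SecondCountableTopology G] [T2Space G]
  [MeasurableSpace G] [BorelSpace G] [(haar : Measure G).IsMulRightInvariant]
  {Γ : Subgroup G} [IsLattice Γ] {Θ : G → Γ} (hΘ : IsDomainCoord Γ Θ)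
  {Ω : Type u} [MeasurableSpace Ω] [MulAction (Γ × Γ) Ω] {m : Measure Ω}

namespace IsDomainCoord

theorem measurable_induced [MeasurableSMul₂ (Γ × Γ) Ω] :
    Measurable fun z : (G × G) × (hΘ.Dom × hΘ.Dom × Ω) => (z.1.1 • z.2.1, z.1.2 • z.2.2.1,
      (hΘ.coc z.1.1 z.2.1, hΘ.coc z.1.2 z.2.2.1) • z.2.2.2) := by
  have h1 : Measurable fun z : (G × G) × (hΘ.Dom × hΘ.Dom × Ω) => hΘ.coc z.1.1 z.2.1 :=
    hΘ.measurable_coc.comp ((measurable_fst.comp measurable_fst).prodMk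
      (measurable_fst.comp measurable_snd))
  have h2 : Measurable fun z : (G × G) × (hΘ.Dom × hΘ.Dom × Ω) => hΘ.coc z.1.2 z.2.2.1 :=
    hΘ.measurable_coc.comp ((measurable_snd.comp measurable_fst).prodMk
      (measurable_fst.comp (measurable_snd.comp measurable_snd)))
  have h3 := (h1.prodMk h2).smul (measurable_snd.comp (measurable_snd.comp
    (measurable_snd (α := G × G) (β := hΘ.Dom × hΘ.Dom × Ω))))
  exact ((measurable_fst.comp measurable_fst).smul (measurable_fst.comp measurable_snd)).prodMk
    (((measurable_snd.comp measurable_fst).smul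
      (measurable_fst.comp (measurable_snd.comp measurable_snd))).prodMk h3)

theorem measurePreserving_induced [SFinite m] [MeasurableSMul₂ (Γ × Γ) Ω]
    [SMulInvariantMeasure (Γ × Γ) Ω m] (g : G × G) :
    MeasurePreserving (fun z : hΘ.Dom × hΘ.Dom × Ω => (g.1 • z.1, g.2 • z.2.1,
      (hΘ.coc g.1 z.1, hΘ.coc g.2 z.2.1) • z.2.2)) (hΘ.vol.prod (hΘ.vol.prod m))
      (hΘ.vol.prod (hΘ.vol.prod m)) := by
  have hm := (hΘ.measurable_induced (Ω := Ω)).comp (measurable_const (a := g).prodMk measurable_id)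
  refine (hΘ.measurePreserving_smul g.1).skew_product
    (g := fun d (w : hΘ.Dom × Ω) => (g.2 • w.1, (hΘ.coc g.1 d, hΘ.coc g.2 w.1) • w.2))
    hm.snd (.of_forall fun d => ?_)
  refine ((hΘ.measurePreserving_smul g.2).skew_product
    (g := fun d' ω => (hΘ.coc g.1 d, hΘ.coc g.2 d') • ω) ?_
    (.of_forall fun d' => (MeasureTheory.measurePreserving_smul _ m).map_eq)).map_eq
  exact (hm.snd.snd).comp (measurable_const (a := d).prodMk measurable_id)

theorem isCoupling_induced (h : IsCoupling Γ Γ m) :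
    letI := hΘ.inducedAction Ω
    IsCoupling G G (hΘ.vol.prod (hΘ.vol.prod m)) := by
  let _ := hΘ.inducedAction Ω
  have := h.standardBorel
  have := h.sigmaFinite
  have := h.measurable_action
  have := h.invariant
  obtain ⟨Y, _, _, ν, _, ⟨i⟩⟩ := h.exists_left
  obtain ⟨X, _, _, μ, _, ⟨j⟩⟩ := h.exists_right
  refine ⟨inferInstance, inferInstance, ?_, ⟨hΘ.measurable_induced⟩,
    ⟨fun g s hs => (hΘ.measurePreserving_induced g).measure_preimage hs.nullMeasurableSet⟩,
    ⟨hΘ.Dom × Y, inferInstance, inferInstance, hΘ.vol.prod ν, inferInstance, ⟨?_⟩⟩,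
    ⟨hΘ.Dom × X, inferInstance, inferInstance, hΘ.vol.prod μ, inferInstance, ⟨?_⟩⟩⟩
  · intro h0
    have := congrArg (fun μ => μ Set.univ) h0
    simp only [← Set.univ_prod_univ, Measure.prod_prod] at this
    simp [hΘ.vol_ne_zero, h.ne_zero] at this
  · rw [hΘ.leftAct_induced]
    exact hΘ.inducedIso i
  · rw [hΘ.rightAct_induced]
    exact (hΘ.inducedIso j).transport (swapFirst hΘ.Dom Ω) (measurePreserving_swapFirst _ _)
      fun _ _ => rfl

theorem isLpIntegrable_induced (h : IsCoupling Γ Γ m) {p : ℝ≥0∞} (hp : 1 ≤ p)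
    (hint : IsLpIntegrable Γ Γ p m) {S : Set Γ} (hS : IsCompactGenerating S) {T : Set G}
    (hT : IsCompactGenerating T)
    (hΘp : ∀ g : G, MemLp (fun d => (wordNorm S (hΘ.coc g d) : ℝ)) p hΘ.vol) :
    letI := hΘ.inducedAction Ω
    IsLpIntegrable G G p (hΘ.vol.prod (hΘ.vol.prod m)) := by
  let _ := hΘ.inducedAction Ω
  have := h.sigmaFinite
  have := h.measurable_action
  have := h.invariant
  have hl := isMPAction_leftAct (G := Γ) (H := Γ) (m := m)
  have hr := isMPAction_rightAct (G := Γ) (H := Γ) (m := m)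
  obtain ⟨⟨Y, _, _, ν, _, i, β, hβ, hβp⟩, ⟨X, _, _, μ, _, j, α, hα, hαp⟩⟩ := hint
  refine ⟨⟨hΘ.Dom × Y, inferInstance, inferInstance, hΘ.vol.prod ν, inferInstance, ?_⟩,
    ⟨hΘ.Dom × X, inferInstance, inferInstance, hΘ.vol.prod μ, inferInstance, ?_⟩⟩
  · rw [hΘ.leftAct_induced, hΘ.rightAct_induced]
    exact ⟨hΘ.inducedIso i, _, hΘ.isMECocycle_inducedIso hβ, hΘ.isLpCocycle_induced hβ hl hr
      leftAct_rightAct_comm hp hβp hS hT hΘp⟩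
  · rw [hΘ.leftAct_induced, hΘ.rightAct_induced]
    exact ⟨(hΘ.inducedIso j).transport (swapFirst hΘ.Dom Ω) (measurePreserving_swapFirst _ _)
      fun _ _ => rfl, _, (hΘ.isMECocycle_inducedIso hα).transport _ _ _ fun _ _ => rfl,
      hΘ.isLpCocycle_induced hα hr hl (fun k l ω => (leftAct_rightAct_comm l k ω).symm) hp hαp hS hT
      hΘp⟩

theorem smul_conj (d : hΘ.Dom) (γ : Γ) : (hΘ.incl d * γ * (hΘ.incl d)⁻¹) • d = d := by
  rw [smul_def, inv_mul_cancel_right, rep_incl_mul]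

theorem coc_conj (d : hΘ.Dom) (γ : Γ) : hΘ.coc (hΘ.incl d * γ * (hΘ.incl d)⁻¹) d = γ := by
  rw [coc, inv_mul_cancel_right, hΘ.equivariant, hΘ.apply_incl]
  simp

/-- If the induced `(G, G)`-coupling is taut relative to `π`, then the `(Γ, Γ)`-coupling is taut
relative to the restriction of `π`: almost every fibre `{(d₁, d₂)} × Ω` is a copy of `Ω` with the
action of the lattices `d₁ Γ d₁⁻¹` and `d₂ Γ d₂⁻¹`. -/
theorem isTautCoupling_of_induced {P : Type v} [Group P] [MeasurableSpace P] [MeasurableMul₂ P]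
    [MeasurableInv P] {π : G →* P} (hπ : Measurable π) [SFinite m]
    (h : letI := hΘ.inducedAction Ω
      IsTautCoupling π (hΘ.vol.prod (hΘ.vol.prod m))) :
    IsTautCoupling (π.comp Γ.subtype) m := by
  let _ := hΘ.inducedAction Ω
  have hsmul : ∀ (g : G × G) (z : hΘ.Dom × hΘ.Dom × Ω), g • z = (g.1 • z.1, g.2 • z.2.1,
    (hΘ.coc g.1 z.1, hΘ.coc g.2 z.2.1) • z.2.2) := fun _ _ => rfl
  have hfib : ∀ {p : hΘ.Dom × hΘ.Dom × Ω → Prop}, (∀ᵐ z ∂hΘ.vol.prod (hΘ.vol.prod m), p z) →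
      ∃ d₁ d₂, ∀ᵐ ω ∂m, p (d₁, d₂, ω) := fun {p} hp => by
    have : NeZero hΘ.vol := ⟨hΘ.vol_ne_zero⟩
    obtain ⟨d₁, h₁⟩ := (Measure.ae_ae_of_ae_prod hp).exists
    obtain ⟨d₂, h₂⟩ := (Measure.ae_ae_of_ae_prod h₁).exists
    exact ⟨d₁, d₂, h₂⟩
  obtain ⟨Φ', ⟨hΦm, hΦe⟩, huniq⟩ := h
  obtain ⟨d₁, d₂, hd⟩ := hfib hΦe
  let Φ : Ω → P := fun ω => (π (hΘ.incl d₁))⁻¹ * Φ' (d₁, d₂, ω) * π (hΘ.incl d₂)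
  have hΦ : IsTautening (π.comp Γ.subtype) m Φ := by
    refine ⟨?_, ?_⟩
    · have h1 : Measurable fun ω : Ω => Φ' (d₁, d₂, ω) :=
        hΦm.comp (measurable_const.prodMk (measurable_const.prodMk measurable_id))
      fun_prop
    · filter_upwards [hd] with ω hω γ₁ γ₂
      have := hω (hΘ.incl d₁ * γ₁ * (hΘ.incl d₁)⁻¹) (hΘ.incl d₂ * γ₂ * (hΘ.incl d₂)⁻¹)
      simp only [hsmul, smul_conj, coc_conj] at this
      simp only [Φ, this, map_mul, map_inv, MonoidHom.comp_apply, Subgroup.coe_subtype]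
      group
  have hind : ∀ Ψ : Ω → P, IsTautening (π.comp Γ.subtype) m Ψ →
      IsTautening π (hΘ.vol.prod (hΘ.vol.prod m))
        (fun z => π (hΘ.incl z.1) * Ψ z.2.2 * (π (hΘ.incl z.2.1))⁻¹) := by
    rintro Ψ ⟨hΨm, hΨe⟩
    refine ⟨?_, ?_⟩
    · have h1 := hΘ.measurable_incl
      fun_prop
    · filter_upwards [ae_prod_snd_snd (α := hΘ.vol) (β := hΘ.vol) hΨe] with z hz g₁ g₂
      simp only [hsmul, hz, incl_smul, map_mul, map_inv, MonoidHom.comp_apply, Subgroup.coe_subtype]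
      group
  refine ⟨Φ, hΦ, fun Ψ hΨ => ?_⟩
  obtain ⟨x₁, x₂, hx⟩ := hfib ((huniq _ (hind Ψ hΨ)).trans (huniq _ (hind Φ hΦ)).symm)
  filter_upwards [hx] with ω hω
  simpa using hω

end IsDomainCoord

end InducedCoupling

/-! ### Integrable lattices -/

section LpLattice

variable {G : Type u} [Group G] [TopologicalSpace G] [IsTopologicalGroup G]
  [LocallyCompactSpace G] [SecondCountableTopology G] [T2Space G]
  [MeasurableSpace G] [BorelSpace G] [(haar : Measure G).IsMulRightInvariant]
  {Γ : Subgroup G} [IsLattice Γ]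

/-- A map that is almost everywhere a coordinate of a fundamental domain agrees almost everywhere
with a strict one: it is replaced by an arbitrary coordinate off a conull `Γ`-invariant set. -/
theorem exists_isDomainCoord_ae_eq {θ : G → Γ} (hθ : Measurable θ)
    (eθ : ∀ γ : Γ, ∀ᵐ x ∂(haar : Measure G), θ (x * (γ : G)⁻¹) = γ * θ x) :
    ∃ Θ : G → Γ, IsDomainCoord Γ Θ ∧ Θ =ᵐ[haar] θ := by
  classical
  have := Γ.countable_of_discrete
  obtain ⟨Θ₀, hΘ₀⟩ := exists_isDomainCoord Γ
  let A : Set G := {x | ∀ γ : Γ, θ (x * γ) = γ⁻¹ * θ x}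
  have hA : MeasurableSet A := by
    have : A = ⋂ γ : Γ, {x | θ (x * γ) = γ⁻¹ * θ x} := by ext; simp [A]
    rw [this]
    exact MeasurableSet.iInter fun γ => measurableSet_eq_fun (by fun_prop) (by fun_prop)
  have hAinv : ∀ (x : G) (γ : Γ), x ∈ A → x * γ ∈ A := fun x γ hx δ => by
    have := hx (γ * δ)
    rw [hx γ, mul_assoc x, ← Subgroup.coe_mul, this]
    group
  have hAiff : ∀ (x : G) (γ : Γ), x * γ ∈ A ↔ x ∈ A := fun x γ =>
    ⟨fun h => by simpa using hAinv _ γ⁻¹ h, hAinv x γ⟩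
  refine ⟨fun x => if x ∈ A then θ x else Θ₀ x, ⟨Measurable.ite hA hθ hΘ₀.measurable,
    fun g γ => ?_⟩, ?_⟩
  · by_cases h : g ∈ A
    · simp only [hAiff, h, if_true]
      exact h γ
    · simp only [hAiff, h, if_false]
      exact hΘ₀.equivariant g γ
  · filter_upwards [ae_all_iff.2 eθ] with x hx
    have : x ∈ A := fun γ => by simpa using hx γ⁻¹
    simp [this]

/-- An `L^p`-integrable lattice has a strict fundamental domain whose cocycle is
`L^p`-integrable, with a linear bound. -/
theorem exists_isDomainCoord_of_isLpLattice {p : ℝ≥0∞} (hp : 1 ≤ p) (h : IsLpLattice p Γ) :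
    (∃ T : Set G, IsCompactGenerating T) ∧
    ∃ (Θ : G → Γ) (hΘ : IsDomainCoord Γ Θ) (S : Set Γ), IsCompactGenerating S ∧
      ∀ T : Set G, IsCompactGenerating T → ∃ M : ℝ≥0∞, M ≠ ∞ ∧
        ∀ g : G, eLpNorm (fun d => (wordNorm S (hΘ.coc g d) : ℝ)) p hΘ.vol ≤
          M * wordNorm T g := by
  let _ : MulAction (G × Γ) G := latticeAction Γ
  have := Γ.countable_of_discrete
  have := haar_isMulRightInvariant_of_discrete Γ
  have hsmul : ∀ (a : G × Γ) (x : G), a • x = a.1 * x * (a.2 : G)⁻¹ := fun _ _ => rfl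
  have : MeasurableSMul₂ (G × Γ) G := ⟨by
    change Measurable fun z : (G × Γ) × G => z.1.1 * z.2 * (z.1.2 : G)⁻¹
    have : Measurable ((↑) : Γ → G) := measurable_subtype_coe
    fun_prop⟩
  have : SMulInvariantMeasure (G × Γ) G (haar : Measure G) := ⟨fun a s hs =>
    ((measurePreserving_mul_right haar (a.2 : G)⁻¹).comp
      (measurePreserving_mul_left haar a.1)).measure_preimage hs.nullMeasurableSet⟩
  obtain ⟨⟨_, _, _, _, _, _, _, _, T, hT, _⟩, ⟨X, _, _, μ, _, j, α, hα, S, hS, hSp⟩⟩ := h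
  refine ⟨⟨T, hT⟩, ?_⟩
  obtain ⟨Θ, hΘ, hΘj⟩ := exists_isDomainCoord_ae_eq j.measurable_coord (fun γ => by
    filter_upwards [j.coord_act γ] with x hx
    rw [← hx]
    simp [rightAct, hsmul])
  refine ⟨Θ, hΘ, S, hS, fun T hT => ?_⟩
  obtain ⟨M, hM, hle⟩ := exists_eLpNorm_cocycle_le j (isMPAction_rightAct (G := G) (H := Γ))
    (isMPAction_leftAct (G := G) (H := Γ))
    (fun k l ω => (leftAct_rightAct_comm l k ω).symm) hα hp hS hSp hT
  refine ⟨M, hM, fun g => le_trans (le_of_eq ?_) (hle g)⟩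
  -- both sides are computed on the set `{Θ = 1}` in `G`
  have hw : Measurable fun γ : Γ => (wordNorm S γ : ℝ) := measurable_of_countable _
  have hmap : hΘ.vol.map hΘ.incl = (haarPoint Γ)⁻¹ • (haar : Measure G).restrict (Θ ⁻¹' {1}) := by
    refine Measure.ext_of_lintegral _ fun f hf => ?_
    rw [lintegral_map hf hΘ.measurable_incl, hΘ.lintegral_vol, lintegral_smul_measure, smul_eq_mul]
  have hset : (Θ ⁻¹' {1} : Set G) =ᵐ[haar] j.coord ⁻¹' {1} := by
    filter_upwards [hΘj] with x hx
    change (Θ x = 1) = (j.coord x = 1)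
    rw [hx]
  have hmap2 := j.map_base (measurableSet_singleton (1 : Γ))
  have hαm : Measurable fun x => (wordNorm S (α (g, x)) : ℝ) :=
    hw.comp (hα.1.comp (measurable_const.prodMk measurable_id))
  have hΘm : Measurable fun x : G => (wordNorm S (Θ (g * x))⁻¹ : ℝ) :=
    hw.comp (hΘ.measurable.comp (measurable_const_mul g)).inv
  have e1 : eLpNorm (fun d => (wordNorm S (hΘ.coc g d) : ℝ)) p hΘ.vol =
      eLpNorm (fun x : G => (wordNorm S (Θ (g * x))⁻¹ : ℝ)) p (hΘ.vol.map hΘ.incl) :=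
    (eLpNorm_map_measure hΘm.aestronglyMeasurable hΘ.measurable_incl.aemeasurable).symm
  have hpt : ∀ᵐ x ∂(haar : Measure G).restrict (j.coord ⁻¹' {1}),
      (Θ (g * x))⁻¹ = α (g, j.base x) := by
    rw [ae_restrict_iff' (j.measurable_coord (measurableSet_singleton _))]
    filter_upwards [hα.ae_eq g, (measurePreserving_mul_left haar g).quasiMeasurePreserving.ae hΘj]
      with x h1 h2 h3
    have h4 : leftAct G Γ g x = g * x := by simp [leftAct, hsmul]
    rw [h1, h4, h2, Set.mem_singleton_iff.1 h3, mul_one]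
  have e2 : eLpNorm (fun x : G => (wordNorm S (Θ (g * x))⁻¹ : ℝ)) p (hΘ.vol.map hΘ.incl) =
      eLpNorm (fun x : G => (wordNorm S (α (g, j.base x)) : ℝ)) p
        ((haarPoint Γ)⁻¹ • (haar : Measure G).restrict (j.coord ⁻¹' {1})) := by
    rw [hmap, Measure.restrict_congr_set hset]
    refine eLpNorm_congr_ae (Measure.ae_smul_measure ?_ _)
    filter_upwards [hpt] with x hx
    rw [hx]
  have e3 : ((haarPoint Γ)⁻¹ • (haar : Measure G).restrict (j.coord ⁻¹' {1})).map j.base = μ := by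
    rw [Measure.map_smul, hmap2, smul_smul]
    change ((haarPoint Γ)⁻¹ * haarPoint Γ) • μ = μ
    rw [ENNReal.inv_mul_cancel (haarPoint_ne_zero Γ) (haarPoint_ne_top Γ), one_smul]
  have e4 := eLpNorm_map_measure (p := p)
    (μ := (haarPoint Γ)⁻¹ • (haar : Measure G).restrict (j.coord ⁻¹' {1}))
    (f := j.base) (g := fun x => (wordNorm S (α (g, x)) : ℝ))
    hαm.aestronglyMeasurable j.measurable_base.aemeasurable
  rw [e3] at e4
  rw [e1, e2, e4]
  rfl

end LpLattice

/-! ### Restricting couplings to a lattice -/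

section Restrict

variable {G : Type u} [Group G] [TopologicalSpace G] [IsTopologicalGroup G]
  [LocallyCompactSpace G] [SecondCountableTopology G] [T2Space G]
  [MeasurableSpace G] [BorelSpace G] [(haar : Measure G).IsMulRightInvariant]
  {Γ : Subgroup G} [IsLattice Γ] {Θ : G → Γ} (hΘ : IsDomainCoord Γ Θ)
  {Ω : Type u} [MeasurableSpace Ω] {m : Measure Ω}
  {Y : Type u} [MeasurableSpace Y] {ν : Measure Y} [IsFiniteMeasure ν]

namespace IsDomainCoord

variable (ν) in
theorem measurePreserving_mul_incl_inv :
    MeasurePreserving (fun z : Γ × (hΘ.Dom × Y) => ((z.1 : G) * (hΘ.incl z.2.1)⁻¹, z.2.2))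
      ((haar : Measure Γ).prod (hΘ.vol.prod ν)) ((haar : Measure G).prod ν) := by
  have := Γ.countable_of_discrete
  have := haar_isMulRightInvariant_of_discrete Γ
  have := haar_isInvInvariant Γ
  have := haar_isInvInvariant G
  have h1 : MeasurePreserving (fun z : Γ × hΘ.Dom => (z.1 : G) * (hΘ.incl z.2)⁻¹)
      ((haar : Measure Γ).prod hΘ.vol) (haar : Measure G) := by
    have h := (measurePreserving_inv (haar : Measure G)).comp
      (hΘ.measurePreserving_mul.comp (((MeasurePreserving.id hΘ.vol).prod
        (measurePreserving_inv (haar : Measure Γ))).comp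
          (Measure.measurePreserving_swap (μ := (haar : Measure Γ)) (ν := hΘ.vol))))
    convert h using 1
    ext z
    simp
  exact (h1.prod (MeasurePreserving.id ν)).comp
    (MeasurePreserving.symm _ (measurePreserving_prodAssoc (haar : Measure Γ) hΘ.vol ν))

theorem apply_inv_mul (γ : Γ) (d : hΘ.Dom) (g : G) :
    Θ (((γ : G) * (hΘ.incl d)⁻¹ * g⁻¹)⁻¹) = γ * (hΘ.coc g d)⁻¹ := by
  have : ((γ : G) * (hΘ.incl d)⁻¹ * g⁻¹)⁻¹ = g * hΘ.incl d * (γ : G)⁻¹ := by group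
  rw [this, hΘ.apply_mul_inv, coc, inv_inv]

/-- A `G`-equivariant isomorphism `G × Y ≅ Ω` restricts to a `Γ`-equivariant isomorphism
`Γ × (D × Y) ≅ Ω`, through `Γ × D ≅ G`, `(γ, d) ↦ γ d⁻¹`. -/
noncomputable def restrictIso {a : G → Ω → Ω} (i : FundamentalIso G a m Y ν) :
    FundamentalIso Γ (fun γ : Γ => a γ) m (hΘ.Dom × Y) (hΘ.vol.prod ν) where
  toFun z := i.toFun ((z.1 : G) * (hΘ.incl z.2.1)⁻¹, z.2.2)
  invFun ω := (Θ (i.invFun ω).1⁻¹, (hΘ.rep (i.invFun ω).1⁻¹, (i.invFun ω).2))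
  measurePreserving_toFun := i.measurePreserving_toFun.comp (hΘ.measurePreserving_mul_incl_inv ν)
  measurable_invFun := by
    have h1 := i.measurable_invFun
    have h2 := hΘ.measurable_rep
    have h3 := hΘ.measurable
    fun_prop
  left_inv := by
    filter_upwards [(hΘ.measurePreserving_mul_incl_inv ν).quasiMeasurePreserving.ae i.left_inv]
      with z hz
    rw [hz]
    have h1 : ((z.1 : G) * (hΘ.incl z.2.1)⁻¹)⁻¹ = hΘ.incl z.2.1 * (z.1⁻¹ : Γ) := by
      simp
    simp only [h1, rep_incl_mul, hΘ.equivariant, hΘ.apply_incl]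
    simp
  right_inv := by
    filter_upwards [i.right_inv] with ω hω
    simp only [incl_rep]
    simpa using hω
  equivariant := by
    filter_upwards [(hΘ.measurePreserving_mul_incl_inv ν).quasiMeasurePreserving.ae i.equivariant]
      with z hz γ
    rw [← hz, Subgroup.coe_mul, mul_assoc]

theorem isMECocycle_restrictIso {a b : G → Ω → Ω} {i : FundamentalIso G a m Y ν}
    {c : G × Y → G} (hc : IsMECocycle i b c) :
    IsMECocycle (hΘ.restrictIso i) (fun γ : Γ => b γ)
      (fun z => hΘ.coc (c ((z.1 : G), z.2.2)) z.2.1) := by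
  refine ⟨?_, fun γ => ?_⟩
  · have h1 : Measurable fun z : Γ × (hΘ.Dom × Y) => c ((z.1 : G), z.2.2) :=
      hc.1.comp ((measurable_subtype_coe.comp measurable_fst).prodMk
        (measurable_snd.comp measurable_snd))
    exact hΘ.measurable_coc.comp (h1.prodMk (measurable_fst.comp measurable_snd))
  · filter_upwards [(hΘ.measurePreserving_mul_incl_inv ν).quasiMeasurePreserving.ae (hc.2 γ)]
      with z hz
    simp only [restrictIso, hz, apply_inv_mul]

theorem isLpCocycle_restrict [SFinite m] {a b : G → Ω → Ω} {i : FundamentalIso G a m Y ν}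
    {c : G × Y → G} (hc : IsMECocycle i b c) (ha : IsMPAction a m) (hb : IsMPAction b m)
    (hab : ∀ k l ω, a k (b l ω) = b l (a k ω)) {p : ℝ≥0∞} (hp : 1 ≤ p)
    (hcp : IsLpCocycle p ν c) {S : Set Γ} (hS : IsCompactGenerating S)
    (hΘp : ∀ T : Set G, IsCompactGenerating T → ∃ M : ℝ≥0∞, M ≠ ∞ ∧
        ∀ g : G, eLpNorm (fun d => (wordNorm S (hΘ.coc g d) : ℝ)) p hΘ.vol ≤ M * wordNorm T g) :
    IsLpCocycle p (hΘ.vol.prod ν)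
      (fun z : Γ × (hΘ.Dom × Y) => hΘ.coc (c ((z.1 : G), z.2.2)) z.2.1) := by
  have := Γ.countable_of_discrete
  obtain ⟨T, hT, hint⟩ := hcp
  obtain ⟨M, hM, hle⟩ := exists_eLpNorm_cocycle_le i ha hb hab hc hp hT hint hT
  obtain ⟨C, hC, hCle⟩ := hΘp T hT
  refine ⟨S, hS, .of_forall fun γ => ?_⟩
  have hcm : Measurable fun y => c ((γ : G), y) :=
    hc.1.comp (measurable_const.prodMk measurable_id)
  have hw : Measurable fun g : G => (wordNorm T g : ℝ) :=
    measurable_from_top.comp (measurable_wordNorm hT)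
  have hn : MemLp (fun y => (wordNorm T (c ((γ : G), y)) : ℝ)) p ν :=
    ⟨(hw.comp hcm).aestronglyMeasurable,
      (hle γ).trans_lt (ENNReal.mul_lt_top hM.lt_top (by simp))⟩
  have hw' : Measurable fun γ : Γ => (wordNorm S γ : ℝ) := measurable_of_countable _
  have hm : Measurable fun z : hΘ.Dom × Y => (wordNorm S (hΘ.coc (c ((γ : G), z.2)) z.1) : ℝ) :=
    hw'.comp (hΘ.measurable_coc.comp ((hcm.comp measurable_snd).prodMk measurable_fst))
  refine memLp_prod_of_eLpNorm_le (zero_lt_one.trans_le hp).ne' hm hn hC fun y => ?_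
  simpa using hCle (c ((γ : G), y))

end IsDomainCoord

variable [MulAction (G × G) Ω]

/-- The restriction of an action of `G × G` to `Γ × Γ`. -/
@[reducible]
def restrictedAction (Γ : Subgroup G) (Ω : Type u) [MulAction (G × G) Ω] :
    MulAction (Γ × Γ) Ω :=
  MulAction.compHom Ω (Γ.subtype.prodMap Γ.subtype)

theorem isCoupling_restrict (h : IsCoupling G G m) :
    letI := restrictedAction Γ Ω
    IsCoupling Γ Γ m := by
  let _ := restrictedAction Γ Ω
  have := h.standardBorel
  have := h.sigmaFinite
  have := h.measurable_action
  have := h.invariant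
  obtain ⟨Θ, hΘ⟩ := exists_isDomainCoord Γ
  obtain ⟨Y, _, _, ν, _, ⟨i⟩⟩ := h.exists_left
  obtain ⟨X, _, _, μ, _, ⟨j⟩⟩ := h.exists_right
  refine ⟨inferInstance, inferInstance, h.ne_zero, ⟨?_⟩,
    ⟨fun g s hs => measure_preimage_smul_of_nullMeasurableSet hs.nullMeasurableSet
      (((g.1 : G), (g.2 : G)) : G × G)⟩,
    ⟨hΘ.Dom × Y, inferInstance, inferInstance, hΘ.vol.prod ν, inferInstance, ⟨?_⟩⟩,
    ⟨hΘ.Dom × X, inferInstance, inferInstance, hΘ.vol.prod μ, inferInstance, ⟨?_⟩⟩⟩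
  · change Measurable fun z : (Γ × Γ) × Ω => ((z.1.1 : G), (z.1.2 : G)) • z.2
    have : Measurable ((↑) : Γ → G) := measurable_subtype_coe
    fun_prop
  · exact hΘ.restrictIso i
  · exact hΘ.restrictIso j

theorem isLpIntegrable_restrict (h : IsCoupling G G m) {p : ℝ≥0∞} (hp : 1 ≤ p)
    (hint : IsLpIntegrable G G p m) (hΓ : IsLpLattice p Γ) :
    letI := restrictedAction Γ Ω
    IsLpIntegrable Γ Γ p m := by
  let _ := restrictedAction Γ Ω
  have := h.sigmaFinite
  have := h.measurable_action
  have := h.invariant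
  have hl := isMPAction_leftAct (G := G) (H := G) (m := m)
  have hr := isMPAction_rightAct (G := G) (H := G) (m := m)
  obtain ⟨-, Θ, hΘ, S, hS, hΘp⟩ := exists_isDomainCoord_of_isLpLattice hp hΓ
  obtain ⟨⟨Y, _, _, ν, _, i, β, hβ, hβp⟩, ⟨X, _, _, μ, _, j, α, hα, hαp⟩⟩ := hint
  refine ⟨⟨hΘ.Dom × Y, inferInstance, inferInstance, hΘ.vol.prod ν, inferInstance, ?_⟩,
    ⟨hΘ.Dom × X, inferInstance, inferInstance, hΘ.vol.prod μ, inferInstance, ?_⟩⟩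
  · exact ⟨hΘ.restrictIso i, _, hΘ.isMECocycle_restrictIso hβ,
      hΘ.isLpCocycle_restrict hβ hl hr leftAct_rightAct_comm hp hβp hS hΘp⟩
  · exact ⟨hΘ.restrictIso j, _, hΘ.isMECocycle_restrictIso hα,
      hΘ.isLpCocycle_restrict hα hr hl (fun k l ω => (leftAct_rightAct_comm l k ω).symm) hp hαp
        hS hΘp⟩

end Restrict

/-! ### Tautness passes from a lattice to the ambient group -/

section Ascent

variable {G : Type u} [Group G] [TopologicalSpace G] [IsTopologicalGroup G]
  [LocallyCompactSpace G] [SecondCountableTopology G] [T2Space G]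
  [MeasurableSpace G] [BorelSpace G] [(haar : Measure G).IsMulRightInvariant]
  {P : Type v} [Group P] [MeasurableSpace P] [StandardBorelSpace P] [MeasurableMul₂ P]
  [MeasurableInv P] {π : G →* P}
  {Ω : Type u} [MeasurableSpace Ω] [MulAction (G × G) Ω] {m : Measure Ω}

theorem measurableSMul₂_prod {K X Y : Type u} [Group K] [MeasurableSpace K] [MeasurableSpace X]
    [MeasurableSpace Y] [MulAction K X] [MulAction K Y] [MeasurableSMul₂ K X]
    [MeasurableSMul₂ K Y] : MeasurableSMul₂ K (X × Y) :=
  ⟨(measurable_fst.smul (measurable_fst.comp measurable_snd)).prodMk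
    (measurable_fst.smul (measurable_snd.comp measurable_snd))⟩

theorem smulInvariantMeasure_prod {K X Y : Type u} [Group K] [MeasurableSpace K]
    [MeasurableSpace X] [MeasurableSpace Y] [MulAction K X] [MulAction K Y] [MeasurableSMul₂ K X]
    [MeasurableSMul₂ K Y] (μ : Measure X) (ν : Measure Y) [SFinite μ] [SFinite ν]
    [SMulInvariantMeasure K X μ] [SMulInvariantMeasure K Y ν] :
    SMulInvariantMeasure K (X × Y) (μ.prod ν) :=
  ⟨fun k _ hs => ((measurePreserving_smul k μ).prod
    (measurePreserving_smul k ν)).measure_preimage hs.nullMeasurableSet⟩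

/-- Let `W` be a finite measure space with a measure preserving action of `G × G`. An equivariant
map `F : W × Ω → P` does not depend on the first coordinate, since `F(w₁, ω)` and `F(w₂, ω)`
are equivariant on `W × W × Ω`. Hence it gives an equivariant map on `Ω`. -/
theorem exists_equivariant_of_prod (h : IsCoupling G G m) (hicc : IsStronglyICCRel π.range)
    {W : Type u} [MeasurableSpace W] [MulAction (G × G) W] [MeasurableSMul₂ (G × G) W]
    (w : Measure W) [IsFiniteMeasure w] [SMulInvariantMeasure (G × G) W w] (hw : w ≠ 0)
    {F : W × Ω → P} (hF : Measurable F)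
    (eF : ∀ g₁ g₂ : G, ∀ᵐ z ∂w.prod m, F ((g₁, g₂) • z) = π g₁ * F z * (π g₂)⁻¹) :
    ∃ Φ : Ω → P, Measurable Φ ∧
      ∀ g₁ g₂ : G, ∀ᵐ ω ∂m, Φ ((g₁, g₂) • ω) = π g₁ * Φ ω * (π g₂)⁻¹ := by
  have := h.sigmaFinite
  have := h.measurable_action
  have := h.invariant
  have : NeZero w := ⟨hw⟩
  have := measurableSMul₂_prod (K := G × G) (X := W) (Y := Ω)
  have := measurableSMul₂_prod (K := G × G) (X := W) (Y := W × Ω)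
  have := smulInvariantMeasure_prod (K := G × G) w m
  have := smulInvariantMeasure_prod (K := G × G) w (w.prod m)
  obtain ⟨X, _, _, μ, _, ⟨j⟩⟩ := h.exists_right
  have h13 : MeasurePreserving (fun z : W × (W × Ω) => (z.2.1, (z.1, z.2.2)))
      (w.prod (w.prod m)) (w.prod (w.prod m)) := measurePreserving_swapFirst w m
  have hsnd : ∀ {p : W × Ω → Prop}, (∀ᵐ z ∂w.prod m, p z) →
      ∀ᵐ z ∂w.prod (w.prod m), p z.2 := fun hp => Measure.quasiMeasurePreserving_snd.ae hp
  have hθ : Measurable fun z : W × (W × Ω) => j.coord z.2.2 := by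
    have := j.measurable_coord
    fun_prop
  have heq : (fun z : W × (W × Ω) => F (z.1, z.2.2)) =ᵐ[w.prod (w.prod m)] fun z => F z.2 := by
    refine ae_eq_of_equivariant hicc hθ (fun k => ?_) (fun E hE hE1 => ?_)
      (hF.comp (measurable_fst.prodMk (measurable_snd.comp measurable_snd)))
      (hF.comp measurable_snd) (fun g₁ g₂ => ?_) (fun g₁ g₂ => hsnd (eF g₁ g₂))
    · exact ae_prod_snd_snd (j.coord_act k)
    · have : (fun z : W × (W × Ω) => j.coord z.2.2) ⁻¹' E =
          Set.univ ×ˢ (Set.univ ×ˢ (j.coord ⁻¹' E)) := by ext; simp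
      rw [this, Measure.prod_prod, Measure.prod_prod, j.measure_coord_preimage hE]
      exact ENNReal.mul_lt_top (measure_lt_top _ _) (ENNReal.mul_lt_top (measure_lt_top _ _)
        (ENNReal.mul_lt_top hE1 (measure_lt_top _ _)))
    · exact h13.quasiMeasurePreserving.ae (hsnd (eF g₁ g₂))
  obtain ⟨w₁, hw₁⟩ := (Measure.ae_ae_of_ae_prod heq).exists
  refine ⟨fun ω => F (w₁, ω), hF.comp (measurable_const.prodMk measurable_id), fun g₁ g₂ => ?_⟩
  have hg : ∀ᵐ z ∂w.prod m, F (w₁, (g₁, g₂) • z.2) = π g₁ * F (w₁, z.2) * (π g₂)⁻¹ := by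
    filter_upwards [hw₁, (measurePreserving_smul ((g₁, g₂) : G × G) (w.prod m)
      ).quasiMeasurePreserving.ae hw₁, eF g₁ g₂] with z h1 h2 h3
    have h2' : F (w₁, (g₁, g₂) • z.2) = F ((g₁, g₂) • z) := h2
    rw [h2', h3, ← h1]
  exact (Measure.ae_ae_of_ae_prod hg).exists.choose_spec

/-- The action of `G × G` on the product of two copies of the fundamental domain. -/
@[reducible]
def IsDomainCoord.pairAction {Γ : Subgroup G} {Θ : G → Γ} (hΘ : IsDomainCoord Γ Θ) :
    MulAction (G × G) (hΘ.Dom × hΘ.Dom) where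
  smul g d := (g.1 • d.1, g.2 • d.2)
  one_smul d := Prod.ext (one_smul G d.1) (one_smul G d.2)
  mul_smul g h d := Prod.ext (mul_smul g.1 h.1 d.1) (mul_smul g.2 h.2 d.2)

/-- If the restricted `(Γ, Γ)`-coupling is taut with tautening map `Φ`, then
`(d₁, d₂, ω) ↦ π(d₁) Φ((d₁, d₂)⁻¹ ω) π(d₂)⁻¹` is a `G × G`-equivariant map on
`G/Γ × G/Γ × Ω`. By the strong ICC property it descends to `Ω`. -/
theorem isTautCoupling_of_restrict {Γ : Subgroup G} [IsLattice Γ] (hπ : Measurable π)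
    (hicc : IsStronglyICCRel π.range) (h : IsCoupling G G m)
    (htaut : letI := restrictedAction Γ Ω
      IsTautCoupling (π.comp Γ.subtype) m) : IsTautCoupling π m := by
  have := h.sigmaFinite
  have := h.measurable_action
  have := h.invariant
  obtain ⟨Θ, hΘ⟩ := exists_isDomainCoord Γ
  let _ := hΘ.pairAction
  have hsmul : ∀ (g : G × G) (d : hΘ.Dom × hΘ.Dom), g • d = (g.1 • d.1, g.2 • d.2) :=
    fun _ _ => rfl
  have : MeasurableSMul₂ (G × G) (hΘ.Dom × hΘ.Dom) := ⟨by
    change Measurable fun z : (G × G) × (hΘ.Dom × hΘ.Dom) => (z.1.1 • z.2.1, z.1.2 • z.2.2)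
    fun_prop⟩
  have : SMulInvariantMeasure (G × G) (hΘ.Dom × hΘ.Dom) (hΘ.vol.prod hΘ.vol) := ⟨fun g s hs =>
    ((hΘ.measurePreserving_smul g.1).prod (hΘ.measurePreserving_smul g.2)).measure_preimage
      hs.nullMeasurableSet⟩
  have hne : hΘ.vol.prod hΘ.vol ≠ 0 := by
    intro h0
    have := congrArg (fun μ => μ Set.univ) h0
    simp only [← Set.univ_prod_univ, Measure.prod_prod] at this
    simp [hΘ.vol_ne_zero] at this
  obtain ⟨Φ, ⟨hΦm, hΦe⟩, huniq⟩ := htaut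
  have hΦe' : ∀ᵐ ω ∂m, ∀ γ₁ γ₂ : Γ,
      Φ (((γ₁ : G), (γ₂ : G)) • ω) = π γ₁ * Φ ω * (π γ₂)⁻¹ := hΦe
  let F : (hΘ.Dom × hΘ.Dom) × Ω → P := fun z => π (hΘ.incl z.1.1) *
    Φ (((hΘ.incl z.1.1)⁻¹, (hΘ.incl z.1.2)⁻¹) • z.2) * (π (hΘ.incl z.1.2))⁻¹
  have hincl := hΘ.measurable_incl
  have hmove : Measurable fun z : (hΘ.Dom × hΘ.Dom) × Ω =>
      ((hΘ.incl z.1.1)⁻¹, (hΘ.incl z.1.2)⁻¹) • z.2 := by fun_prop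
  have hF : Measurable F := by
    have := hΦm.comp hmove
    fun_prop
  have hmp : MeasurePreserving (fun z : (hΘ.Dom × hΘ.Dom) × Ω =>
      (z.1, ((hΘ.incl z.1.1)⁻¹, (hΘ.incl z.1.2)⁻¹) • z.2)) ((hΘ.vol.prod hΘ.vol).prod m)
      ((hΘ.vol.prod hΘ.vol).prod m) :=
    (MeasurePreserving.id _).skew_product (g := fun (d : hΘ.Dom × hΘ.Dom) (ω : Ω) =>
      ((hΘ.incl d.1)⁻¹, (hΘ.incl d.2)⁻¹) • ω) hmove
      (.of_forall fun d => (measurePreserving_smul _ m).map_eq)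
  obtain ⟨Φ₀, hΦ₀, eΦ₀⟩ := exists_equivariant_of_prod h hicc (hΘ.vol.prod hΘ.vol) hne hF
    fun g₁ g₂ => by
      filter_upwards [hmp.quasiMeasurePreserving.ae (Measure.quasiMeasurePreserving_snd.ae hΦe')]
        with z hz
      have hz' := hz (hΘ.coc g₁ z.1.1) (hΘ.coc g₂ z.1.2)
      simp only [smul_smul, Prod.mk_mul_mk] at hz'
      have e : ∀ (g : G) (d : hΘ.Dom),
          (hΘ.incl (g • d))⁻¹ * g = hΘ.coc g d * (hΘ.incl d)⁻¹ := fun g d => by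
        rw [hΘ.incl_smul]; group
      simp only [F, Prod.smul_fst, Prod.smul_snd, hsmul, smul_smul, Prod.mk_mul_mk, e, hz']
      simp only [hΘ.incl_smul, map_mul, map_inv]
      group
  obtain ⟨Φ₁, hΦ₁⟩ := exists_isTautening hπ hΦ₀ eΦ₀
  -- uniqueness holds already for the restriction to `Γ`
  have hres : ∀ Ψ : Ω → P, IsTautening π m Ψ → Ψ =ᵐ[m] Φ := fun Ψ hΨ =>
    huniq Ψ ⟨hΨ.1, hΨ.2.mono fun ω hω γ₁ γ₂ => hω γ₁ γ₂⟩
  exact ⟨Φ₁, hΦ₁, fun Ψ hΨ => (hres Ψ hΨ).trans (hres Φ₁ hΦ₁).symm⟩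

end Ascent

/-! ### Tautness of a group and of its lattices -/

section Lattice

variable {G : Type u} [Group G] [TopologicalSpace G] [IsTopologicalGroup G]
  [LocallyCompactSpace G] [SecondCountableTopology G] [T2Space G]
  [MeasurableSpace G] [BorelSpace G] [(haar : Measure G).IsMulRightInvariant]
  {P : Type v} [Group P] [MeasurableSpace P] [MeasurableMul₂ P] [MeasurableInv P] {π : G →* P}
  {Γ : Subgroup G} [IsLattice Γ]

/-- Tautness passes from a group to its lattices; no ICC hypothesis is needed. -/
theorem MeasEquiv.IsTautRel.comp_subtype (hπ : Measurable π) (hG : IsTautRel π) :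
    IsTautRel (π.comp Γ.subtype) := by
  intro Ω _ _ m h
  obtain ⟨Θ, hΘ⟩ := exists_isDomainCoord Γ
  have := h.sigmaFinite
  refine hΘ.isTautCoupling_of_induced hπ ?_
  let _ := hΘ.inducedAction Ω
  exact hG _ _ (hΘ.isCoupling_induced h)

theorem MeasEquiv.IsPTautRel.comp_subtype (hπ : Measurable π) {p : ℝ≥0∞} (hp : 1 ≤ p)
    (hΓ : IsLpLattice p Γ) (hG : IsPTautRel p π) : IsPTautRel p (π.comp Γ.subtype) := by
  intro Ω _ _ m h hint
  obtain ⟨⟨T, hT⟩, Θ, hΘ, S, hS, hbound⟩ := exists_isDomainCoord_of_isLpLattice hp hΓ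
  obtain ⟨M, hM, hle⟩ := hbound T hT
  have := h.sigmaFinite
  have : Countable Γ := Γ.countable_of_discrete
  have hLp (g : G) : MemLp (fun d => (wordNorm S (hΘ.coc g d) : ℝ)) p hΘ.vol := by
    have hmeas : Measurable fun d => (wordNorm S (hΘ.coc g d) : ℝ) :=
      (measurable_of_countable fun γ : Γ => (wordNorm S γ : ℝ)).comp
        (hΘ.measurable_coc.comp measurable_prodMk_left)
    exact ⟨hmeas.aestronglyMeasurable,
      (hle g).trans_lt (ENNReal.mul_lt_top hM.lt_top (ENNReal.natCast_lt_top _))⟩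
  refine hΘ.isTautCoupling_of_induced hπ ?_
  let _ := hΘ.inducedAction Ω
  exact hG _ _ (hΘ.isCoupling_induced h) (hΘ.isLpIntegrable_induced h hp hint hS hT hLp)

theorem MeasEquiv.IsTautRel.of_comp_subtype [StandardBorelSpace P] (hπ : Measurable π)
    (hicc : IsStronglyICCRel π.range) (hΓ : IsTautRel (π.comp Γ.subtype)) : IsTautRel π := by
  intro Ω _ _ m h
  refine isTautCoupling_of_restrict (Γ := Γ) hπ hicc h ?_
  let _ := restrictedAction Γ Ω
  exact hΓ _ _ (isCoupling_restrict h)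

theorem MeasEquiv.IsPTautRel.of_comp_subtype [StandardBorelSpace P] (hπ : Measurable π)
    (hicc : IsStronglyICCRel π.range) {p : ℝ≥0∞} (hp : 1 ≤ p) (hLp : IsLpLattice p Γ)
    (hΓ : IsPTautRel p (π.comp Γ.subtype)) : IsPTautRel p π := by
  intro Ω _ _ m h hint
  refine isTautCoupling_of_restrict (Γ := Γ) hπ hicc h ?_
  let _ := restrictedAction Γ Ω
  exact hΓ _ _ (isCoupling_restrict h) (isLpIntegrable_restrict h hp hint hLp)

variable (Γ) in
/-- For the identity of `G` the strong ICC hypothesis is automatic: tautness of `G`, or of `Γ`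
relative to `G`, implies that `G` is strongly ICC relative to `Γ`. -/
theorem isTaut_iff_isTautRel_subtype : IsTaut G ↔ IsTautRel Γ.subtype := by
  have := standardBorelSpace_of_lcsc G
  refine ⟨fun h => h.comp_subtype measurable_id, fun h => ?_⟩
  have : Countable Γ := Γ.countable_of_discrete
  have := haar_isMulRightInvariant_of_discrete Γ
  have hicc : IsStronglyICCRel Γ.subtype.range := h.isStronglyICCRel measurable_subtype_coe
  exact IsTautRel.of_comp_subtype (Γ := Γ) measurable_id
    (hicc.mono fun x _ => ⟨x, rfl⟩) h

end Lattice

theorem propositionP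
    {G : Type u} [Group G] [TopologicalSpace G] [IsTopologicalGroup G]
    [LocallyCompactSpace G] [SecondCountableTopology G] [T2Space G]
    [MeasurableSpace G] [BorelSpace G]
    (unimodular : (haar : Measure G).IsMulRightInvariant)
    {P : Type v} [Group P] [TopologicalSpace P] [IsTopologicalGroup P] [PolishSpace P]
    [MeasurableSpace P] [BorelSpace P]
    (π : G →* P) (hπ : Continuous π)
    (Γ : Subgroup G) [IsLattice Γ] :
    (IsStronglyICCRel π.range →
      (IsTautRel π ↔ IsTautRel (π.comp Γ.subtype)) ∧
      (∀ p : ℝ≥0∞, 1 ≤ p → IsLpLattice p Γ →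
        (IsPTautRel p π ↔ IsPTautRel p (π.comp Γ.subtype)))) ∧
    (IsTaut G ↔ IsTautRel Γ.subtype) ∧
    (IsTaut G ↔ ∃ (Δ : Subgroup G) (_ : IsLattice Δ), IsTautRel Δ.subtype) ∧
    (IsTaut G ↔ ∀ (Δ : Subgroup G) [IsLattice Δ], IsTautRel Δ.subtype) := by
  have := standardBorelSpace_of_lcsc G
  have hπm : Measurable π := hπ.measurable
  refine ⟨fun hicc => ⟨⟨fun h => h.comp_subtype hπm, fun h => h.of_comp_subtype hπm hicc⟩,
      fun p hp hLp => ⟨fun h => h.comp_subtype hπm hp hLp,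
        fun h => h.of_comp_subtype hπm hicc hp hLp⟩⟩,
    isTaut_iff_isTautRel_subtype Γ,
    ⟨fun h => ⟨Γ, inferInstance, (isTaut_iff_isTautRel_subtype Γ).1 h⟩,
      fun ⟨Δ, _, h⟩ => (isTaut_iff_isTautRel_subtype Δ).2 h⟩,
    ⟨fun h Δ _ => (isTaut_iff_isTautRel_subtype Δ).1 h,
      fun h => (isTaut_iff_isTautRel_subtype Γ).2 (h Γ)⟩⟩
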